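/- Notation. For an integer row matrix $A=(a_1\;\cdots\;a_n)$ and $\beta\in\mathbb C$, let $\mathcal D$ be the sheaf of linear differential operators with holomorphic coefficients on $X=\mathbb C^n$, with coordinates $x_1,\dots,x_n$ and $\partial_j=\partial/\partial x_j$. Let $H_A(\beta)$ be the left ideal of the Weyl algebra generated by $\sum_j a_jx_j\partial_j-\beta$ and by the binomials $\partial^{u_+}-\partial^{u_-}$ for all $u\in\mathbb Z^n$ with $\sum_j a_ju_j=0$ (where $u=u_+-u_-$ with $u_\pm\in\mathbb N^n$ of disjoint supports). The hypergeometric system is the sheaf of left $\mathcal D$-modules $\mathcal M_A(\beta)=\mathcal D/\mathcal D H_A(\beta)$. The restriction of $\mathcal M_A(\beta)$ to $X'=\{x_1=\cdots=x_m=0\}$ is the sheaf on $X'$ $$\frac{\mathcal D}{\mathcal D H_A(\beta)+(x_1,\dots,x_m)\mathcal D},$$ a left module over the sheaf $\mathcal D'$ of linear differential operators with holomorphic coefficients on $X'$ (operators in $x_{m+1},\dots,x_n$, acting by left multiplication). (1) Let $k,a,b$ be positive integers with $a<b$, $1<ka$ and $\gcd(a,b)=1$, and let $A=(1\; ka\;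 kb)$ and $A'=(a\; b)$. Then for every $\beta\in\mathbb C$ there exist $\beta_0,\dots,\beta_{k-1}\in\mathbb C$ and an isomorphism of sheaves of left $\mathcal D'$-modules on $\{x_1=0\}$ $$\frac{\mathcal D}{\mathcal D H_A(\beta)+x_1\mathcal D}\;\simeq\;\bigoplus_{i=0}^{k-1}\mathcal M_{A'}(\beta_i).$$ Moreover, for all but finitely many $\beta\in\mathbb C$ one can take $\beta_i=\frac{\beta-i}{k}$ for $i=0,\dots,k-1$. (2) Let $n\ge 2$, let $A=(1\; a_2\;\cdots\; a_n)$ be an integer row matrix with $1<a_2<\cdots<a_n$ (and $a_1=1$), and let $A'=(a_{n-1}\; a_n)$ and $k=\gcd(a_{n-1},a_n)$. Then for every $\beta\in\mathbb C$ there exist $\beta_0,\dots,\beta_{k-1}\in\mathbb C$ and an isomorphism of sheaves of left $\mathcal D'$-modules on $\{x_1=\cdots=x_{n-2}=0\}$ $$\frac{\mathcal D}{\mathcal D H_A(\beta)+(x_1,\dots,x_{n-2})\mathcal D}\;\simeq\;\bigoplus_{i=0}^{k-1}\mathcal M_{A'}(\beta_i).$$ Moreover, for all but finitely many $\beta\in\mathbb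 C$ one can take $\beta_i=\beta-i$ for $i=0,\dots,k-1$. -/

import Mathlib

open Filter Topology TopologicalSpace

noncomputable section

namespace GKZ

/-! ### Germs of holomorphic functions on `ℂⁿ` -/

/-- The stalk `𝒪_{X,p}` of the sheaf of holomorphic functions on `X = ℂⁿ`. -/
def HolGerm {n : ℕ} (p : Fin n → ℂ) : Subring (Germ (𝓝 p) ℂ) where
  carrier := {φ | ∃ f : (Fin n → ℂ) → ℂ, AnalyticAt ℂ f p ∧ (f : Germ (𝓝 p) ℂ) = φ}
  mul_mem' := by
    rintro _ _ ⟨f, hf, rfl⟩ ⟨g, hg, rfl⟩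
    exact ⟨f * g, hf.mul hg, rfl⟩
  one_mem' := ⟨1, analyticAt_const, rfl⟩
  add_mem' := by
    rintro _ _ ⟨f, hf, rfl⟩ ⟨g, hg, rfl⟩
    exact ⟨f + g, hf.add hg, rfl⟩
  zero_mem' := ⟨0, analyticAt_const, rfl⟩
  neg_mem' := by
    rintro _ ⟨f, hf, rfl⟩
    exact ⟨-f, hf.neg, rfl⟩

/-- The germ at `p` of a function that is holomorphic near `p`. -/
def germ {n : ℕ} {p : Fin n → ℂ} (f : (Fin n → ℂ) → ℂ) (hf : AnalyticAt ℂ f p) : HolGerm p :=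
  ⟨(f : Germ (𝓝 p) ℂ), f, hf, rfl⟩

/-- The germ of the `j`-th coordinate function. -/
def coord {n : ℕ} {p : Fin n → ℂ} (j : Fin n) : HolGerm p :=
  germ (fun x => x j)
    ((ContinuousLinearMap.proj (R := ℂ) (φ := fun _ : Fin n => ℂ) j).analyticAt p)

/-- The germ of a constant function. -/
def constGerm {n : ℕ} {p : Fin n → ℂ} (c : ℂ) : HolGerm p :=
  germ (fun _ => c) analyticAt_const

/-- The `i`-th partial derivative of a function on `ℂⁿ`. -/
def partialFun {n : ℕ} (i : Fin n) (f : (Fin n → ℂ) → ℂ) : (Fin n → ℂ) → ℂ :=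
  fun x => fderiv ℂ f x (Pi.single i 1)

theorem analyticAt_partialFun {n : ℕ} {p : Fin n → ℂ} (i : Fin n) {f : (Fin n → ℂ) → ℂ}
    (hf : AnalyticAt ℂ f p) : AnalyticAt ℂ (partialFun i f) p :=
  ((ContinuousLinearMap.apply ℂ ℂ (Pi.single i 1 : Fin n → ℂ)).analyticAt _).comp hf.fderiv

/-- The `i`-th partial derivative of a holomorphic germ. -/
def partialGerm {n : ℕ} {p : Fin n → ℂ} (i : Fin n) (φ : HolGerm p) : HolGerm p :=
  ⟨Germ.map' (partialFun i) (fun _ _ h => h.fderiv.fun_comp fun L => L (Pi.single i 1)) φ.1, by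
    obtain ⟨_, f, hf, rfl⟩ := φ
    exact ⟨partialFun i f, analyticAt_partialFun i hf, rfl⟩⟩

/-! ### The sheaf of linear differential operators with holomorphic coefficients -/

/-- The defining relations of the stalk of `𝒟` at `p`, in the generators `f ∈ 𝒪_p` (left summand)
and `∂₁, …, ∂ₙ` (right summand). -/
inductive DRel {n : ℕ} (p : Fin n → ℂ) :
    FreeAlgebra ℂ (HolGerm p ⊕ Fin n) → FreeAlgebra ℂ (HolGerm p ⊕ Fin n) → Prop
  | add (f g : HolGerm p) : DRel p (FreeAlgebra.ι ℂ (Sum.inl (f + g)))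
      (FreeAlgebra.ι ℂ (Sum.inl f) + FreeAlgebra.ι ℂ (Sum.inl g))
  | mul (f g : HolGerm p) : DRel p (FreeAlgebra.ι ℂ (Sum.inl (f * g)))
      (FreeAlgebra.ι ℂ (Sum.inl f) * FreeAlgebra.ι ℂ (Sum.inl g))
  | const (c : ℂ) : DRel p (FreeAlgebra.ι ℂ (Sum.inl (constGerm c)))
      (algebraMap ℂ (FreeAlgebra ℂ (HolGerm p ⊕ Fin n)) c)
  | comm (i j : Fin n) : DRel p
      (FreeAlgebra.ι ℂ (Sum.inr i) * FreeAlgebra.ι ℂ (Sum.inr j))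
      (FreeAlgebra.ι ℂ (Sum.inr j) * FreeAlgebra.ι ℂ (Sum.inr i))
  | leibniz (i : Fin n) (f : HolGerm p) : DRel p
      (FreeAlgebra.ι ℂ (Sum.inr i) * FreeAlgebra.ι ℂ (Sum.inl f))
      (FreeAlgebra.ι ℂ (Sum.inl f) * FreeAlgebra.ι ℂ (Sum.inr i)
        + FreeAlgebra.ι ℂ (Sum.inl (partialGerm i f)))

/-- The stalk `𝒟_{X,p} = 𝒪_{X,p}⟨∂₁, …, ∂ₙ⟩` of the sheaf of linear differential operators with
holomorphic coefficients on `X = ℂⁿ`: the `ℂ`-algebra generated by the algebra `𝒪_{X,p}` and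
commuting symbols `∂ᵢ` with `∂ᵢ f = f ∂ᵢ + ∂f/∂xᵢ`. -/
def DStalk {n : ℕ} (p : Fin n → ℂ) : Type := RingQuot (DRel p)

instance {n : ℕ} (p : Fin n → ℂ) : Ring (DStalk p) := inferInstanceAs (Ring (RingQuot (DRel p)))

instance {n : ℕ} (p : Fin n → ℂ) : Algebra ℂ (DStalk p) :=
  inferInstanceAs (Algebra ℂ (RingQuot (DRel p)))

/-- The canonical map from the free algebra. -/
def DStalk.mk {n : ℕ} (p : Fin n → ℂ) : FreeAlgebra ℂ (HolGerm p ⊕ Fin n) →ₐ[ℂ] DStalk p :=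
  RingQuot.mkAlgHom ℂ (DRel p)

theorem DStalk.mk_surjective {n : ℕ} (p : Fin n → ℂ) : Function.Surjective (DStalk.mk p) :=
  RingQuot.mkAlgHom_surjective ℂ (DRel p)

theorem DStalk.mk_rel {n : ℕ} {p : Fin n → ℂ} {x y : FreeAlgebra ℂ (HolGerm p ⊕ Fin n)}
    (h : DRel p x y) : DStalk.mk p x = DStalk.mk p y :=
  RingQuot.mkAlgHom_rel ℂ h

/-- A holomorphic germ as an operator of order zero. -/
def fn {n : ℕ} {p : Fin n → ℂ} (f : HolGerm p) : DStalk p :=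
  DStalk.mk p (FreeAlgebra.ι ℂ (Sum.inl f))

/-- The operator `∂ᵢ`. -/
def pd {n : ℕ} {p : Fin n → ℂ} (i : Fin n) : DStalk p :=
  DStalk.mk p (FreeAlgebra.ι ℂ (Sum.inr i))

theorem fn_add {n : ℕ} {p : Fin n → ℂ} (f g : HolGerm p) : fn (f + g) = fn f + fn g := by
  simpa [fn] using DStalk.mk_rel (DRel.add f g)

theorem fn_mul {n : ℕ} {p : Fin n → ℂ} (f g : HolGerm p) : fn (f * g) = fn f * fn g := by
  simpa [fn] using DStalk.mk_rel (DRel.mul f g)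

theorem fn_const {n : ℕ} {p : Fin n → ℂ} (c : ℂ) :
    fn (constGerm c : HolGerm p) = algebraMap ℂ (DStalk p) c := by
  simpa [fn] using DStalk.mk_rel (DRel.const (p := p) c)

theorem pd_comm {n : ℕ} {p : Fin n → ℂ} (i j : Fin n) :
    (pd i * pd j : DStalk p) = pd j * pd i := by
  simpa [pd] using DStalk.mk_rel (DRel.comm (p := p) i j)

theorem pd_fn {n : ℕ} {p : Fin n → ℂ} (i : Fin n) (f : HolGerm p) :
    pd i * fn f = fn f * pd i + fn (partialGerm i f) := by
  simpa [pd, fn] using DStalk.mk_rel (DRel.leibniz i f)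

/-- The universal property of the stalk of `𝒟`. -/
def DStalk.lift {n : ℕ} {p : Fin n → ℂ} {B : Type} [Ring B] [Algebra ℂ B]
    (F : HolGerm p → B) (d : Fin n → B)
    (hadd : ∀ f g, F (f + g) = F f + F g) (hmul : ∀ f g, F (f * g) = F f * F g)
    (hconst : ∀ c, F (constGerm c) = algebraMap ℂ B c) (hcomm : ∀ i j, d i * d j = d j * d i)
    (hleib : ∀ i f, d i * F f = F f * d i + F (partialGerm i f)) : DStalk p →ₐ[ℂ] B :=
  RingQuot.liftAlgHom ℂ ⟨FreeAlgebra.lift ℂ (Sum.elim F d), by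
    rintro _ _ (⟨f, g⟩ | ⟨f, g⟩ | ⟨c⟩ | ⟨i, j⟩ | ⟨i, f⟩)
    · simpa using hadd f g
    · simpa using hmul f g
    · simpa using hconst c
    · simpa using hcomm i j
    · simpa using hleib i f⟩

theorem DStalk.lift_mk {n : ℕ} {p : Fin n → ℂ} {B : Type} [Ring B] [Algebra ℂ B]
    (F : HolGerm p → B) (d : Fin n → B) (h1 h2 h3 h4 h5) (x : HolGerm p ⊕ Fin n) :
    DStalk.lift F d h1 h2 h3 h4 h5 (DStalk.mk p (FreeAlgebra.ι ℂ x)) = Sum.elim F d x :=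
  (RingQuot.liftAlgHom_mkAlgHom_apply ℂ _ _ _).trans (FreeAlgebra.lift_ι_apply _ _)

/-- Restriction of families indexed by the points of an open set. -/
def resFun {n : ℕ} {F : (Fin n → ℂ) → Type} {V U : Opens (Fin n → ℂ)} (h : V ≤ U)
    (s : ∀ q : U, F q.1) : ∀ q : V, F q.1 :=
  fun q => s ⟨q.1, h q.2⟩

/-- The operators `∑ f_α ∂^α` on the open set `V`, with finitely many terms and coefficients
holomorphic on `V`, as families of germs: the algebra generated by the holomorphic functions
on `V` and the `∂ᵢ`. -/
def DPre {n : ℕ} (V : Opens (Fin n → ℂ)) : Subalgebra ℂ (∀ q : V, DStalk q.1) :=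
  Algebra.adjoin ℂ
    ({P | ∃ (f : (Fin n → ℂ) → ℂ) (hf : ∀ q : V, AnalyticAt ℂ f q.1),
        P = fun q => fn (germ f (hf q))} ∪
      Set.range fun i : Fin n => fun _ : V => pd i)

theorem resFun_mem_DPre {n : ℕ} {V W : Opens (Fin n → ℂ)} (h : W ≤ V)
    {P : ∀ q : V, DStalk q.1} (hP : P ∈ DPre V) : resFun (F := DStalk) h P ∈ DPre W := by
  let ρ : (∀ q : V, DStalk q.1) →ₐ[ℂ] (∀ q : W, DStalk q.1) :=
    { toFun := resFun (F := DStalk) h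
      map_one' := rfl
      map_mul' := fun _ _ => rfl
      map_zero' := rfl
      map_add' := fun _ _ => rfl
      commutes' := fun _ => rfl }
  have key : DPre V ≤ (DPre W).comap ρ := by
    refine Algebra.adjoin_le ?_
    rintro _ (⟨f, hf, rfl⟩ | ⟨i, rfl⟩)
    · exact Algebra.subset_adjoin (Or.inl ⟨f, fun q => hf ⟨q.1, h q.2⟩, rfl⟩)
    · exact Algebra.subset_adjoin (Or.inr ⟨i, rfl⟩)
  exact key hP

/-- The sections over `U` of the sheaf `𝒟` of linear differential operators with holomorphic
coefficients: families of germs that are locally given by operators `∑ f_α ∂^α`. -/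
def DSec {n : ℕ} (U : Opens (Fin n → ℂ)) : Subalgebra ℂ (∀ q : U, DStalk q.1) where
  carrier := {P | ∀ p : U, ∃ (V : Opens (Fin n → ℂ)) (h : V ≤ U), p.1 ∈ V ∧
    resFun (F := DStalk) h P ∈ DPre V}
  mul_mem' := by
    intro P Q hP hQ p
    obtain ⟨V, hV, hpV, h1⟩ := hP p
    obtain ⟨W, hW, hpW, h2⟩ := hQ p
    exact ⟨V ⊓ W, inf_le_left.trans hV, ⟨hpV, hpW⟩,
      mul_mem (resFun_mem_DPre inf_le_left h1) (resFun_mem_DPre inf_le_right h2)⟩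
  add_mem' := by
    intro P Q hP hQ p
    obtain ⟨V, hV, hpV, h1⟩ := hP p
    obtain ⟨W, hW, hpW, h2⟩ := hQ p
    exact ⟨V ⊓ W, inf_le_left.trans hV, ⟨hpV, hpW⟩,
      add_mem (resFun_mem_DPre inf_le_left h1) (resFun_mem_DPre inf_le_right h2)⟩
  algebraMap_mem' := fun c p => ⟨U, le_rfl, p.2, (DPre U).algebraMap_mem c⟩

theorem resFun_mem_DSec {n : ℕ} {U V : Opens (Fin n → ℂ)} (h : V ≤ U)
    {P : ∀ q : U, DStalk q.1} (hP : P ∈ DSec U) : resFun (F := DStalk) h P ∈ DSec V := by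
  intro p
  obtain ⟨W, hW, hpW, h1⟩ := hP ⟨p.1, h p.2⟩
  exact ⟨W ⊓ V, inf_le_right, ⟨hpW, p.2⟩, resFun_mem_DPre inf_le_left h1⟩

/-! ### Hypergeometric systems of a row matrix -/

/-- The monomial `∂^u = ∂₁^{u₁} ⋯ ∂ₙ^{uₙ}`. -/
def pdPow {n : ℕ} {p : Fin n → ℂ} (u : Fin n → ℕ) : DStalk p :=
  (List.ofFn fun i => (pd i : DStalk p) ^ u i).prod

/-- The binomial `□_u = ∂^{u₊} - ∂^{u₋}`. -/
def box {n : ℕ} {p : Fin n → ℂ} (u : Fin n → ℤ) : DStalk p :=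
  pdPow (fun i => (u i).toNat) - pdPow (fun i => (-u i).toNat)

/-- The Euler operator `E_A(β) = ∑ⱼ aⱼ xⱼ ∂ⱼ - β`. -/
def euler {n : ℕ} {p : Fin n → ℂ} (A : Fin n → ℤ) (β : ℂ) : DStalk p :=
  ∑ j, (A j : ℂ) • (fn (coord j) * pd j) - algebraMap ℂ (DStalk p) β

/-- The stalk at `p` of the left ideal `𝒟 H_A(β)`, generated by the `□_u` with `A u = 0` and by
the Euler operator. -/
def hypIdeal {n : ℕ} (A : Fin n → ℤ) (β : ℂ) (p : Fin n → ℂ) :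
    Submodule (DStalk p) (DStalk p) :=
  Submodule.span (DStalk p)
    ({P | ∃ u : Fin n → ℤ, ∑ j, A j * u j = 0 ∧ P = box u} ∪ {euler A β})

/-- The stalk at `p` of `ℳ_A(β) = 𝒟 / 𝒟 H_A(β)`. -/
abbrev MStalk {n : ℕ} (A : Fin n → ℤ) (β : ℂ) (p : Fin n → ℂ) : Type :=
  DStalk p ⧸ hypIdeal A β p

/-- The `𝒟(U)`-module of sections over `U` of the quotient sheaf `ℳ_A(β) = 𝒟 / 𝒟 H_A(β)`:
families of classes of germs that are locally induced by sections of `𝒟`. -/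
def MSec {n : ℕ} (A : Fin n → ℤ) (β : ℂ) (U : Opens (Fin n → ℂ)) :
    Submodule (DSec U) (∀ q : U, MStalk A β q.1) where
  carrier := {s | ∀ p : U, ∃ (V : Opens (Fin n → ℂ)) (h : V ≤ U), p.1 ∈ V ∧
    ∃ P ∈ DSec V, ∀ q : V, s ⟨q.1, h q.2⟩ = (hypIdeal A β q.1).mkQ (P q)}
  add_mem' := by
    intro s t hs ht p
    obtain ⟨V, hV, hpV, P, hP, h1⟩ := hs p
    obtain ⟨W, hW, hpW, Q, hQ, h2⟩ := ht p
    refine ⟨V ⊓ W, inf_le_left.trans hV, ⟨hpV, hpW⟩, _,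
      add_mem (resFun_mem_DSec inf_le_left hP) (resFun_mem_DSec inf_le_right hQ), fun q => ?_⟩
    have e1 := h1 ⟨q.1, q.2.1⟩
    have e2 := h2 ⟨q.1, q.2.2⟩
    simp only [Pi.add_apply, resFun, map_add] at e1 e2 ⊢
    rw [e1, e2]
  zero_mem' := fun p => ⟨U, le_rfl, p.2, 0, zero_mem _, fun q => by simp⟩
  smul_mem' := by
    intro Q s hs p
    obtain ⟨V, hV, hpV, P, hP, h1⟩ := hs p
    refine ⟨V, hV, hpV, _, mul_mem (resFun_mem_DSec hV Q.2) hP, fun q => ?_⟩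
    change Q.1 ⟨q.1, hV q.2⟩ • s ⟨q.1, hV q.2⟩ =
      (hypIdeal A β q.1).mkQ (Q.1 ⟨q.1, hV q.2⟩ • P q)
    rw [h1 q, map_smul]

/-- The restriction maps of the sheaf `ℳ_A(β)`. -/
def MSec.res {n : ℕ} {A : Fin n → ℤ} {β : ℂ} {U V : Opens (Fin n → ℂ)} (h : V ≤ U)
    (s : MSec A β U) : MSec A β V :=
  ⟨resFun (F := MStalk A β) h s.1, by
    intro p
    obtain ⟨W, hW, hpW, P, hP, h1⟩ := s.2 ⟨p.1, h p.2⟩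
    exact ⟨W ⊓ V, inf_le_right, ⟨hpW, p.2⟩, _, resFun_mem_DSec inf_le_left hP,
      fun q => h1 ⟨q.1, q.2.1⟩⟩⟩

/-! ### Restriction to `x₁ = ⋯ = xₘ = 0` -/

/-- The inclusion `X' = ℂʳ → X = ℂ^{m+r}` of the subspace `x₁ = ⋯ = xₘ = 0`. -/
def incl (m : ℕ) {r : ℕ} (p : Fin r → ℂ) : Fin (m + r) → ℂ := Fin.append 0 p

/-- The projection `X = ℂ^{m+r} → X' = ℂʳ` to the last `r` coordinates. -/
def projL (m r : ℕ) : (Fin (m + r) → ℂ) →L[ℂ] (Fin r → ℂ) :=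
  ContinuousLinearMap.pi fun j => ContinuousLinearMap.proj (Fin.natAdd m j)

theorem projL_incl (m : ℕ) {r : ℕ} (p : Fin r → ℂ) : projL m r (incl m p) = p := by
  ext j
  simp [projL, incl]

theorem continuous_incl (m r : ℕ) : Continuous (incl m : (Fin r → ℂ) → (Fin (m + r) → ℂ)) := by
  refine continuous_pi fun i => ?_
  refine Fin.addCases (fun i => ?_) (fun i => ?_) i
  · simpa [incl] using continuous_const
  · simpa [incl] using continuous_apply i

theorem tendsto_projL (m : ℕ) {r : ℕ} (p : Fin r → ℂ) :
    Tendsto (projL m r) (𝓝 (incl m p)) (𝓝 p) := by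
  simpa only [projL_incl] using (projL m r).continuous.tendsto (incl m p)

theorem analyticAt_comp_projL (m : ℕ) {r : ℕ} {q : Fin (m + r) → ℂ} {f : (Fin r → ℂ) → ℂ}
    (hf : AnalyticAt ℂ f (projL m r q)) : AnalyticAt ℂ (fun x => f (projL m r x)) q :=
  AnalyticAt.comp (g := f) hf ((projL m r).analyticAt q)

/-- A germ in `x_{m+1}, …, x_{m+r}` regarded as a germ in all the variables. -/
def pull (m : ℕ) {r : ℕ} {p : Fin r → ℂ} (φ : HolGerm p) : HolGerm (incl m p) :=
  ⟨φ.1.compTendsto (projL m r) (tendsto_projL m p), by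
    obtain ⟨_, f, hf, rfl⟩ := φ
    exact ⟨fun x => f (projL m r x), analyticAt_comp_projL m (by rwa [projL_incl]), rfl⟩⟩

theorem partialGerm_pull (m : ℕ) {r : ℕ} {p : Fin r → ℂ} (j : Fin r) (φ : HolGerm p) :
    partialGerm (Fin.natAdd m j) (pull m φ) = pull m (partialGerm j φ) := by
  obtain ⟨_, f, hf, rfl⟩ := φ
  apply Subtype.ext
  refine Germ.coe_eq.2 ?_
  filter_upwards [(tendsto_projL m p).eventually hf.eventually_analyticAt] with x hx
  change fderiv ℂ (fun y => f (projL m r y)) x _ = fderiv ℂ f (projL m r x) _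
  have h : HasFDerivAt (fun y => f (projL m r y))
      ((fderiv ℂ f (projL m r x)).comp (projL m r)) x :=
    hx.differentiableAt.hasFDerivAt.comp x (projL m r).hasFDerivAt
  rw [h.fderiv]
  change fderiv ℂ f (projL m r x) _ = _
  congr 1
  ext i
  by_cases hij : i = j
  · subst hij; simp [projL]
  · simp [projL, hij]

/-- The inclusion `𝒟' → 𝒟` of the operators in the last `r` variables. -/
def extOp (m : ℕ) {r : ℕ} (p : Fin r → ℂ) : DStalk p →ₐ[ℂ] DStalk (incl m p) :=
  DStalk.lift (fun f => fn (pull m f)) (fun j => pd (Fin.natAdd m j))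
    (fun f g => by
      rw [← fn_add]; congr 1
      obtain ⟨_, f, hf, rfl⟩ := f
      obtain ⟨_, g, hg, rfl⟩ := g
      rfl)
    (fun f g => by
      rw [← fn_mul]; congr 1
      obtain ⟨_, f, hf, rfl⟩ := f
      obtain ⟨_, g, hg, rfl⟩ := g
      rfl)
    (fun c => fn_const c) (fun i j => pd_comm _ _)
    (fun i f => by rw [pd_fn, partialGerm_pull])

theorem extOp_fn (m : ℕ) {r : ℕ} (p : Fin r → ℂ) (f : HolGerm p) :
    extOp m p (fn f) = fn (pull m f) :=
  DStalk.lift_mk _ _ _ _ _ _ _ (Sum.inl f)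

theorem extOp_pd (m : ℕ) {r : ℕ} (p : Fin r → ℂ) (j : Fin r) :
    extOp m p (pd j) = pd (Fin.natAdd m j) :=
  DStalk.lift_mk _ _ _ _ _ _ _ (Sum.inr j)

/-- The operators in the last variables commute with the first coordinates. -/
theorem extOp_mul_coord (m : ℕ) {r : ℕ} (p : Fin r → ℂ) (i : Fin m) (Q : DStalk p) :
    extOp m p Q * fn (coord (Fin.castAdd r i)) = fn (coord (Fin.castAdd r i)) * extOp m p Q := by
  obtain ⟨x, rfl⟩ := DStalk.mk_surjective p Q
  induction x using FreeAlgebra.induction with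
  | grade0 c => simp only [AlgHom.commutes]; exact Algebra.commutes c _
  | grade1 y =>
    rcases y with f | j
    · change extOp m p (fn f) * _ = _ * extOp m p (fn f)
      rw [extOp_fn, ← fn_mul, ← fn_mul, mul_comm]
    · change extOp m p (pd j) * _ = _ * extOp m p (pd j)
      rw [extOp_pd, pd_fn]
      have h0 : partialGerm (Fin.natAdd m j) (coord (Fin.castAdd r i) : HolGerm (incl m p))
          = constGerm 0 := by
        apply Subtype.ext
        refine Germ.coe_eq.2 (Eventually.of_forall fun x => ?_)
        change fderiv ℂ (ContinuousLinearMap.proj (R := ℂ) (φ := fun _ : Fin (m + r) => ℂ)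
          (Fin.castAdd r i)) x _ = 0
        rw [ContinuousLinearMap.fderiv]
        have hne : Fin.castAdd r i ≠ Fin.natAdd m j := by
          intro h
          have := congrArg Fin.val h
          simp at this
          omega
        simp [hne]
      rw [h0, fn_const]
      simp
  | mul x y hx hy => simp only [map_mul]; rw [mul_assoc, hy, ← mul_assoc, hx, mul_assoc]
  | add x y hx hy => simp only [map_add]; rw [add_mul, hx, hy, mul_add]

/-- The stalk of `𝒟` at the point `p` of `X' = {x₁ = ⋯ = xₘ = 0}`, as a left `𝒟'`-module. -/
def DExt (m : ℕ) {r : ℕ} (p : Fin r → ℂ) : Type := DStalk (incl m p)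

instance (m : ℕ) {r : ℕ} (p : Fin r → ℂ) : AddCommGroup (DExt m p) :=
  inferInstanceAs (AddCommGroup (DStalk (incl m p)))

instance (m : ℕ) {r : ℕ} (p : Fin r → ℂ) : Module (DStalk p) (DExt m p) :=
  Module.compHom (DStalk (incl m p)) (extOp m p).toRingHom

/-- The stalk at a point of `X'` of `𝒟 H_A(β) + (x₁, …, xₘ) 𝒟`, as a left `𝒟'`-submodule
of `𝒟`. -/
def restrSub {m r : ℕ} (A : Fin (m + r) → ℤ) (β : ℂ) (p : Fin r → ℂ) :
    Submodule (DStalk p) (DExt m p) where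
  carrier := {P | ∃ H ∈ hypIdeal A β (incl m p), ∃ C : Fin m → DStalk (incl m p),
    P = (H + ∑ i, fn (coord (Fin.castAdd r i)) * C i : DStalk (incl m p))}
  add_mem' := by
    rintro _ _ ⟨H, hH, C, rfl⟩ ⟨K, hK, E, rfl⟩
    refine ⟨H + K, add_mem hH hK, C + E, ?_⟩
    simp only [Pi.add_apply, mul_add, Finset.sum_add_distrib]
    exact add_add_add_comm (G := DStalk (incl m p)) _ _ _ _
  zero_mem' := ⟨0, zero_mem _, 0, by simp; rfl⟩
  smul_mem' := by
    rintro Q _ ⟨H, hH, C, rfl⟩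
    refine ⟨extOp m p Q * H, Submodule.smul_mem _ (extOp m p Q) hH, fun i => extOp m p Q * C i, ?_⟩
    change extOp m p Q * (H + _) = _
    rw [mul_add, Finset.mul_sum]
    congr 1
    refine Finset.sum_congr rfl fun i _ => ?_
    rw [← mul_assoc, extOp_mul_coord, mul_assoc]

/-- The stalk at `p ∈ X'` of `𝒟 / (𝒟 H_A(β) + (x₁, …, xₘ) 𝒟)`. -/
abbrev RStalk {m r : ℕ} (A : Fin (m + r) → ℤ) (β : ℂ) (p : Fin r → ℂ) : Type :=
  DExt m p ⧸ restrSub A β p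

/-- The class in `𝒟 / (𝒟 H_A(β) + (x₁, …, xₘ) 𝒟)` of a germ of an operator. -/
def RStalk.mk {m r : ℕ} (A : Fin (m + r) → ℤ) (β : ℂ) (p : Fin r → ℂ)
    (P : DStalk (incl m p)) : RStalk A β p :=
  (restrSub A β p).mkQ P

/-- The inverse image in `X` of an open subset of `X'`. -/
def cyl (m : ℕ) {r : ℕ} (U : Opens (Fin r → ℂ)) : Opens (Fin (m + r) → ℂ) :=
  ⟨projL m r ⁻¹' U, U.2.preimage (projL m r).continuous⟩

/-- The open subset `V ∩ X'` of `X'`. -/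
def slice {m r : ℕ} (V : Opens (Fin (m + r) → ℂ)) : Opens (Fin r → ℂ) :=
  ⟨incl m ⁻¹' V, V.2.preimage (continuous_incl m r)⟩

/-- Sections of `𝒟'` over `U` extend to sections of `𝒟` over the inverse image of `U`. -/
theorem exists_extOp_mem_DPre (m : ℕ) {r : ℕ} {U : Opens (Fin r → ℂ)} {Q : ∀ q : U, DStalk q.1}
    (hQ : Q ∈ DPre U) : ∃ P ∈ DPre (cyl m U), ∀ (q : U) (hq : incl m q.1 ∈ cyl m U),
      P ⟨incl m q.1, hq⟩ = extOp m q.1 (Q q) := by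
  refine Algebra.adjoin_induction (p := fun Q _ => ∃ P ∈ DPre (cyl m U),
    ∀ (q : U) (hq : incl m q.1 ∈ cyl m U), P ⟨incl m q.1, hq⟩ = extOp m q.1 (Q q))
    ?_ ?_ ?_ ?_ hQ
  · rintro _ (⟨f, hf, rfl⟩ | ⟨i, rfl⟩)
    · refine ⟨_, Algebra.subset_adjoin (Or.inl ⟨fun x => f (projL m r x),
        fun q => analyticAt_comp_projL m (hf ⟨_, q.2⟩), rfl⟩), fun q hq => ?_⟩
      rw [extOp_fn]
      rfl
    · refine ⟨_, Algebra.subset_adjoin (Or.inr ⟨Fin.natAdd m i, rfl⟩), fun q hq => ?_⟩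
      rw [extOp_pd]
  · intro c
    exact ⟨_, (DPre (cyl m U)).algebraMap_mem c, fun q hq => ((extOp m q.1).commutes c).symm⟩
  · rintro x y _ _ ⟨P, hP, h1⟩ ⟨P', hP', h2⟩
    refine ⟨P + P', add_mem hP hP', fun q hq => ?_⟩
    rw [Pi.add_apply, Pi.add_apply, h1, h2, map_add]
  · rintro x y _ _ ⟨P, hP, h1⟩ ⟨P', hP', h2⟩
    refine ⟨P * P', mul_mem hP hP', fun q hq => ?_⟩
    rw [Pi.mul_apply, Pi.mul_apply, h1, h2, map_mul]

theorem mem_DSec_of_mem_DPre {n : ℕ} {V : Opens (Fin n → ℂ)} {P : ∀ q : V, DStalk q.1}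
    (hP : P ∈ DPre V) : P ∈ DSec V :=
  fun p => ⟨V, le_rfl, p.2, hP⟩

/-- The `𝒟'(U)`-module of sections over the open set `U ⊆ X'` of the restriction
`𝒟 / (𝒟 H_A(β) + (x₁, …, xₘ) 𝒟)` of `ℳ_A(β)` to `X' = {x₁ = ⋯ = xₘ = 0}`: families of classes of
germs at the points of `U` that are locally induced by sections of `𝒟` over open subsets of `X`. -/
def RSec {m r : ℕ} (A : Fin (m + r) → ℤ) (β : ℂ) (U : Opens (Fin r → ℂ)) :
    Submodule (DSec U) (∀ q : U, RStalk A β q.1) where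
  carrier := {s | ∀ p : U, ∃ V : Opens (Fin (m + r) → ℂ), incl m p.1 ∈ V ∧
    ∃ P ∈ DSec V, ∀ (q : U) (hq : incl m q.1 ∈ V),
      s q = RStalk.mk A β q.1 (P ⟨incl m q.1, hq⟩)}
  add_mem' := by
    intro s t hs ht p
    obtain ⟨V, hpV, P, hP, h1⟩ := hs p
    obtain ⟨W, hpW, Q, hQ, h2⟩ := ht p
    refine ⟨V ⊓ W, ⟨hpV, hpW⟩, _,
      add_mem (resFun_mem_DSec inf_le_left hP) (resFun_mem_DSec inf_le_right hQ), fun q hq => ?_⟩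
    rw [Pi.add_apply, h1 q hq.1, h2 q hq.2]
    rfl
  zero_mem' := fun p => ⟨⊤, trivial, 0, zero_mem _, fun q _ => rfl⟩
  smul_mem' := by
    intro Q s hs p
    obtain ⟨V, hpV, P, hP, h1⟩ := hs p
    obtain ⟨W, hW, hpW, hQ⟩ := Q.2 p
    obtain ⟨Q', hQ', h2⟩ := exists_extOp_mem_DPre m hQ
    refine ⟨cyl m W ⊓ V, ⟨?_, hpV⟩, _, mul_mem
      (resFun_mem_DSec inf_le_left (mem_DSec_of_mem_DPre hQ')) (resFun_mem_DSec inf_le_right hP),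
      fun q hq => ?_⟩
    · change projL m r (incl m p.1) ∈ W
      rwa [projL_incl]
    · have hqW : q.1 ∈ W := by
        have : projL m r (incl m q.1) ∈ W := hq.1
        rwa [projL_incl] at this
      have e := h2 ⟨q.1, hqW⟩ hq.1
      change Q.1 q • s q = RStalk.mk A β q.1 (Q' ⟨incl m q.1, hq.1⟩ * P ⟨incl m q.1, hq.2⟩)
      rw [e, h1 q hq.2]
      rfl

/-- The restriction maps of the sheaf `𝒟 / (𝒟 H_A(β) + (x₁, …, xₘ) 𝒟)` on `X'`. -/
def RSec.res {m r : ℕ} {A : Fin (m + r) → ℤ} {β : ℂ} {U V : Opens (Fin r → ℂ)} (h : V ≤ U)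
    (s : RSec A β U) : RSec A β V :=
  ⟨resFun (F := RStalk A β) h s.1, by
    intro p
    obtain ⟨W, hpW, P, hP, h1⟩ := s.2 ⟨p.1, h p.2⟩
    exact ⟨W, hpW, P, hP, fun q hq => h1 ⟨q.1, h q.2⟩ hq⟩⟩

/-- `RestrictionIso A β A' b` says that, as sheaves of left `𝒟'`-modules on
`X' = {x₁ = ⋯ = xₘ = 0}`, there is an isomorphism
`𝒟 / (𝒟 H_A(β) + (x₁, …, xₘ) 𝒟) ≅ ⨁_{i < k} ℳ_{A'}(bᵢ)`: a family of `𝒟'(U)`-linear isomorphisms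
on sections over all open `U`, compatible with the restriction maps. -/
def RestrictionIso {m r k : ℕ} (A : Fin (m + r) → ℤ) (β : ℂ) (A' : Fin r → ℤ) (b : Fin k → ℂ) :
    Prop :=
  ∃ φ : ∀ U : Opens (Fin r → ℂ), RSec A β U ≃ₗ[DSec U] (∀ i : Fin k, MSec A' (b i) U),
    ∀ (U V : Opens (Fin r → ℂ)) (h : V ≤ U) (s : RSec A β U) (i : Fin k),
      φ V (RSec.res h s) i = MSec.res h (φ U s i)

end GKZ

end

/-! Write ∂₁ for the derivative with weight a₁ = 1. Modulo the toric relations ∂ⱼ ≡ ∂₁^{aⱼ}, and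
modulo x₁, …, xₘ coefficients may be restricted to X'. So the restriction is generated over 𝒟' by
the classes of ∂₁^l, l ∈ ℕ. They satisfy ∂ⱼ·[∂₁^l] = [∂₁^{l+aⱼ}] for the last two variables, and
H_{A'}(β - l) kills [∂₁^l] when A' consists of the last two entries: commuting ∂₁^l past x₁∂₁ shifts
β by l (`hypIdeal_smul_rStalk_mk`).

Let S be the semigroup generated by the last two entries, k their gcd, and cᵢ ∈ ℕ with cᵢ ≡ i mod k
for i < k. The sets cᵢ + S are disjoint, and their union has finite complement in ℕ. Suppose that β
is not in this complement. For l in the complement, the Euler relation (β - l)[∂₁^l] = ∑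
aⱼxⱼ[∂₁^{l+aⱼ}] can be solved for [∂₁^l]; by descending induction the k classes [∂₁^{cᵢ}] generate
(`powSec_mem_span`).

To see that there are no further relations, let 𝒟 act on 𝒪[X] with ∂ᵢ acting as ∂ᵢ + X^{aᵢ}, which
is formally conjugation by exp(∑ xᵢX^{aᵢ}). Then P ↦ P·1 kills the toric relations, and right
multiplication by the Euler operator becomes the 𝒟-linear operator E = ∑ aⱼxⱼX^{aⱼ} + X d/dX - β.
All of this is compatible with setting x₁ = ⋯ = xₘ = 0. A relation ∑ Pᵢ[∂₁^{cᵢ}] = 0 therefore gives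
∑ X^{cᵢ}(Pᵢ·1) = E g over 𝒪'. Comparing coefficients, the factors l - β ≠ 0 force g to be supported
in the union of the cᵢ + S. Hence g = ∑ X^{cᵢ}(Gᵢ·1), and disjointness of the supports shows that
each Pᵢ - Gᵢ E_{A'}(β - cᵢ) kills 1. In two variables such operators lie in the toric ideal, so Pᵢ ∈
𝒟'H_{A'}(β - cᵢ) (`mem_hypIdeal_of_sum_eq_eulerEnd`).

For generic β one takes cᵢ = i. If β = l ∈ ℕ, replacing the representative of l mod k by l itself
puts β into the union. Generation is proved with coefficients holomorphic on open sets and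
independence on stalks; together they give bijectivity on sections. -/

open Filter Topology TopologicalSpace

noncomputable section

namespace GKZ

/-! ### The lemma of Hadamard for analytic functions -/

section Hadamard

variable {E : Type*} [NormedAddCommGroup E] [NormedSpace ℂ E]

/-- The power series of `G` in `f z - f (π z) = G z (z - π z)`, where `f` has the power
series `p`. -/
def hadamardSeries (p : FormalMultilinearSeries ℂ E ℂ) (π : E →L[ℂ] E) :
    FormalMultilinearSeries ℂ E (E →L[ℂ] ℂ) := fun n =>
  ∑ i : Fin (n + 1), ((p (n + 1)).curryMid i).flipMultilinear.compContinuousLinearMap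
    (fun j => if j.castSucc < i then ContinuousLinearMap.id ℂ E else π)

/-- Telescoping: replace the arguments `π z` by `z` one at a time. The `i`-th step has `z - π z` in
slot `i`, `z` before it and `π z` after it. -/
theorem hadamardSeries_apply (p : FormalMultilinearSeries ℂ E ℂ) (π : E →L[ℂ] E) (n : ℕ) (z : E) :
    hadamardSeries p π n (fun _ => z) (z - π z) =
      p (n + 1) (fun _ => z) - p (n + 1) (fun _ => π z) := by
  have h := (p (n + 1)).toMultilinearMap.map_piecewise_sub_map_piecewise
    (fun _ => z) (fun _ => π z) 0 Finset.univ
  simp only [Finset.piecewise_univ, Finset.mem_univ, if_true] at h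
  refine Eq.trans ?_ h.symm
  simp only [hadamardSeries, sum_apply]
  refine Finset.sum_congr rfl fun i _ => ?_
  simp only [ContinuousMultilinearMap.compContinuousLinearMap_apply,
    ContinuousLinearMap.flipMultilinear_apply_apply, ContinuousMultilinearMap.curryMid_apply]
  change p (n + 1) _ = p (n + 1) _
  congr 1
  funext j
  refine Fin.succAboveCases i ?_ (fun j => ?_) j
  · simp
  · rw [Fin.insertNth_apply_succAbove]
    by_cases hj : j.castSucc < i
    · simp [hj, Fin.succAbove_of_castSucc_lt]
    · have h1 : i < j.succ := Fin.le_castSucc_iff.1 (not_lt.1 hj)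
      simp [hj, Fin.succAbove_of_le_castSucc _ _ (not_lt.1 hj), h1.not_gt, h1.ne']

theorem norm_hadamardSeries_le (p : FormalMultilinearSeries ℂ E ℂ) {π : E →L[ℂ] E}
    (hπ : ‖π‖ ≤ 1) (n : ℕ) : ‖hadamardSeries p π n‖ ≤ (n + 1) * ‖p (n + 1)‖ := by
  have key : ∀ i : Fin (n + 1), ‖((p (n + 1)).curryMid i).flipMultilinear.compContinuousLinearMap
      (fun j => if j.castSucc < i then ContinuousLinearMap.id ℂ E else π)‖ ≤ ‖p (n + 1)‖ := by
    intro i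
    refine (ContinuousMultilinearMap.norm_compContinuousLinearMap_le _ _).trans ?_
    have h1 : ‖((p (n + 1)).curryMid i).flipMultilinear‖ ≤ ‖p (n + 1)‖ := by
      refine (MultilinearMap.mkContinuous_norm_le _ (norm_nonneg _) _).trans ?_
      rw [ContinuousMultilinearMap.norm_curryMid]
    have h2 : ∏ j : Fin n, ‖if j.castSucc < i then ContinuousLinearMap.id ℂ E else π‖ ≤ 1 := by
      refine Finset.prod_le_one (fun _ _ => norm_nonneg _) fun j _ => ?_
      split_ifs
      · exact ContinuousLinearMap.norm_id_le
      · exact hπ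
    calc _ ≤ ‖p (n + 1)‖ * 1 := by gcongr
      _ = _ := mul_one _
  refine (norm_sum_le_of_le (E := ContinuousMultilinearMap ℂ (fun _ : Fin n => E) (E →L[ℂ] ℂ))
    Finset.univ fun i _ => key i).trans ?_
  simp

theorem radius_hadamardSeries_pos {p : FormalMultilinearSeries ℂ E ℂ} {π : E →L[ℂ] E}
    (hπ : ‖π‖ ≤ 1) (hp : 0 < p.radius) : 0 < (hadamardSeries p π).radius := by
  obtain ⟨C, r, hC, hr, h⟩ := p.le_mul_pow_of_radius_pos hp
  have hr2 : 0 < (2 * r)⁻¹ := by positivity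
  refine lt_of_lt_of_le (ENNReal.coe_pos.2 (show (0 : NNReal) < ⟨(2 * r)⁻¹, hr2.le⟩ from hr2))
    ((hadamardSeries p π).le_radius_of_bound (C * r) fun n => ?_)
  change ‖hadamardSeries p π n‖ * (2 * r)⁻¹ ^ n ≤ C * r
  -- The number `n + 1` of summands is absorbed by halving the radius.
  have h3 : ((n : ℝ) + 1) ≤ 2 ^ n := by exact_mod_cast Nat.lt_two_pow_self
  calc ‖hadamardSeries p π n‖ * (2 * r)⁻¹ ^ n
      ≤ ((n + 1) * (C * r ^ (n + 1))) * (2 * r)⁻¹ ^ n := by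
        gcongr
        exact (norm_hadamardSeries_le p hπ n).trans (by gcongr; exact h (n + 1))
    _ ≤ (2 ^ n * (C * r ^ (n + 1))) * (2 * r)⁻¹ ^ n := by gcongr
    _ = C * r * ((2 * r) ^ n * (2 * r)⁻¹ ^ n) := by rw [mul_pow]; ring
    _ = C * r := by rw [← mul_pow, mul_inv_cancel₀ (by positivity), one_pow, mul_one]

/-- The lemma of Hadamard for analytic functions. -/
theorem exists_analyticAt_hadamard {f : E → ℂ} {x : E} (hf : AnalyticAt ℂ f x) {π : E →L[ℂ] E}
    (hπ : ‖π‖ ≤ 1) (hx : π x = x) :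
    ∃ G : E → E →L[ℂ] ℂ, AnalyticAt ℂ G x ∧ ∀ᶠ y in 𝓝 x, f y - f (π y) = G y (y - π y) := by
  obtain ⟨p, r, hp⟩ := hf
  set P := hadamardSeries p π
  have hP : 0 < P.radius := radius_hadamardSeries_pos hπ (hp.r_pos.trans_le hp.r_le)
  have hQ := (P.hasFPowerSeriesOnBall hP).comp_sub x
  rw [zero_add] at hQ
  refine ⟨fun y => P.sum (y - x), hQ.analyticAt, ?_⟩
  have hr : 0 < min r P.radius := lt_min hp.r_pos hP
  filter_upwards [Metric.eball_mem_nhds x hr] with y hy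
  have hz : y - x ∈ Metric.eball (0 : E) (min r P.radius) := by
    simpa [Metric.mem_eball, edist_eq_enorm_sub] using hy
  set z := y - x with hzdef
  have hy' : y = x + z := by simp [hzdef]
  have hz1 : z ∈ Metric.eball (0 : E) r := Metric.eball_subset_eball (min_le_left _ _) hz
  have hz2 : z ∈ Metric.eball (0 : E) P.radius := Metric.eball_subset_eball (min_le_right _ _) hz
  have hz3 : π z ∈ Metric.eball (0 : E) r := by
    simp only [Metric.mem_eball, edist_zero_right] at hz1 ⊢
    refine lt_of_le_of_lt ?_ hz1
    rw [enorm_le_iff_norm_le]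
    exact (π.le_opNorm z).trans (mul_le_of_le_one_left (norm_nonneg _) hπ)
  have s1 := (hp.hasSum hz1).sub (hp.hasSum hz3)
  have s2 := (P.hasSum hz2).mapL (ContinuousLinearMap.apply ℂ ℂ (z - π z))
  simp only [ContinuousLinearMap.apply_apply] at s2
  -- Since `π` fixes the centre and does not increase norms, `y` and `π y` lie in the same ball of
  -- convergence.
  have e1 : π y = x + π z := by rw [hy', map_add, hx]
  have e2 : y - π y = z - π z := by rw [e1, hy']; abel
  rw [e2, e1]
  conv_lhs => rw [hy']
  rw [← hasSum_nat_add_iff' 1] at s1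
  simp only [Finset.range_one, Finset.sum_singleton] at s1
  -- The constant terms cancel, which is why the series of `G` starts from the linear term of `f`.
  have e0 : p 0 (fun _ => z) - p 0 (fun _ => π z) = 0 := by
    rw [sub_eq_zero]; congr 1; funext i; exact i.elim0
  rw [e0, sub_zero] at s1
  refine s1.unique ?_
  convert s2 using 2 with n
  exact (hadamardSeries_apply p π n z).symm

end Hadamard

/-! ### The differential algebra of holomorphic germs -/

section Germs

variable {n : ℕ} {p : Fin n → ℂ}

theorem exists_eq_germ (φ : HolGerm p) :
    ∃ (f : (Fin n → ℂ) → ℂ) (hf : AnalyticAt ℂ f p), φ = germ f hf := by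
  obtain ⟨_, f, hf, rfl⟩ := φ
  exact ⟨f, hf, rfl⟩

theorem germ_eq_germ {f g : (Fin n → ℂ) → ℂ} {hf : AnalyticAt ℂ f p} {hg : AnalyticAt ℂ g p}
    (h : f =ᶠ[𝓝 p] g) : germ f hf = germ g hg :=
  Subtype.ext (Germ.coe_eq.2 h)

instance : Algebra ℂ (HolGerm p) :=
  RingHom.toAlgebra
    { toFun := fun c => constGerm c
      map_one' := rfl
      map_mul' := fun _ _ => rfl
      map_zero' := rfl
      map_add' := fun _ _ => rfl }

theorem algebraMap_holGerm (c : ℂ) : algebraMap ℂ (HolGerm p) c = constGerm c := rfl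

theorem sum_germ {ι : Type*} (s : Finset ι) {F : ι → (Fin n → ℂ) → ℂ}
    (hF : ∀ i, AnalyticAt ℂ (F i) p) : ∑ i ∈ s, germ (F i) (hF i) =
      germ (fun x => ∑ i ∈ s, F i x) (Finset.analyticAt_fun_sum s fun i _ => hF i) := by
  apply Subtype.ext
  rw [AddSubmonoidClass.coe_finsetSum]
  refine Eq.trans (map_sum (Germ.coeRingHom (R := ℂ) (𝓝 p)) F s).symm ?_
  refine Germ.coe_eq.2 (Eventually.of_forall fun x => ?_)
  simp

theorem partialGerm_add (i : Fin n) (φ ψ : HolGerm p) :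
    partialGerm i (φ + ψ) = partialGerm i φ + partialGerm i ψ := by
  obtain ⟨f, hf, rfl⟩ := exists_eq_germ φ
  obtain ⟨g, hg, rfl⟩ := exists_eq_germ ψ
  refine germ_eq_germ (hf := analyticAt_partialFun i (hf.add hg))
    (hg := (analyticAt_partialFun i hf).add (analyticAt_partialFun i hg)) ?_
  filter_upwards [hf.eventually_analyticAt, hg.eventually_analyticAt] with x hx hy
  simp [partialFun, fderiv_add hx.differentiableAt hy.differentiableAt]

theorem partialGerm_mul (i : Fin n) (φ ψ : HolGerm p) :
    partialGerm i (φ * ψ) = φ * partialGerm i ψ + ψ * partialGerm i φ := by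
  obtain ⟨f, hf, rfl⟩ := exists_eq_germ φ
  obtain ⟨g, hg, rfl⟩ := exists_eq_germ ψ
  refine germ_eq_germ (hf := analyticAt_partialFun i (hf.mul hg))
    (hg := (hf.mul (analyticAt_partialFun i hg)).add (hg.mul (analyticAt_partialFun i hf))) ?_
  filter_upwards [hf.eventually_analyticAt, hg.eventually_analyticAt] with x hx hy
  simp [partialFun, fderiv_mul hx.differentiableAt hy.differentiableAt]

theorem partialGerm_algebraMap (i : Fin n) (c : ℂ) :
    partialGerm i (algebraMap ℂ (HolGerm p) c) = 0 := by
  refine germ_eq_germ (hf := analyticAt_partialFun i analyticAt_const)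
    (hg := analyticAt_const) (Eventually.of_forall fun x => ?_)
  simp [partialFun]

/-- Both sides are values of the second Fréchet derivative, which is symmetric. -/
theorem partialGerm_comm (i j : Fin n) (φ : HolGerm p) :
    partialGerm i (partialGerm j φ) = partialGerm j (partialGerm i φ) := by
  obtain ⟨f, hf, rfl⟩ := exists_eq_germ φ
  refine germ_eq_germ (hf := analyticAt_partialFun i (analyticAt_partialFun j hf))
    (hg := analyticAt_partialFun j (analyticAt_partialFun i hf)) ?_
  filter_upwards [hf.eventually_analyticAt] with x hx
  have hd : DifferentiableAt ℂ (fderiv ℂ f) x := hx.fderiv.differentiableAt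
  have key : ∀ k l : Fin n, partialFun k (partialFun l f) x =
      fderiv ℂ (fderiv ℂ f) x (Pi.single k 1) (Pi.single l 1) := by
    intro k l
    have := (hd.hasFDerivAt.clm_apply (hasFDerivAt_const (Pi.single l 1 : Fin n → ℂ) x)).fderiv
    change fderiv ℂ (fun y => fderiv ℂ f y (Pi.single l 1)) x (Pi.single k 1) = _
    rw [this]
    simp
  rw [key, key]
  exact (hx.contDiffAt (n := 2)).isSymmSndFDerivAt (by simp) _ _

theorem analyticAt_coord (j : Fin n) (p : Fin n → ℂ) :
    AnalyticAt ℂ (fun x : Fin n → ℂ => x j) p :=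
  (ContinuousLinearMap.proj (R := ℂ) (φ := fun _ : Fin n => ℂ) j).analyticAt p

theorem partialGerm_coord (i j : Fin n) :
    partialGerm i (coord j : HolGerm p) = if i = j then 1 else 0 := by
  have h : ∀ x : Fin n → ℂ, partialFun i (fun x => x j) x = if i = j then 1 else 0 := by
    intro x
    change fderiv ℂ (ContinuousLinearMap.proj (R := ℂ) (φ := fun _ : Fin n => ℂ) j) x _ = _
    rw [ContinuousLinearMap.fderiv]
    simp [Pi.single_apply, eq_comm]
  split_ifs with hij
  · exact germ_eq_germ (hf := analyticAt_partialFun i (analyticAt_coord j p)) (hg := analyticAt_const)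
      (Eventually.of_forall fun x => by rw [h, if_pos hij])
  · exact germ_eq_germ (hf := analyticAt_partialFun i (analyticAt_coord j p)) (hg := analyticAt_const)
      (Eventually.of_forall fun x => by rw [h, if_neg hij])

/-- The partial derivative as a derivation of the algebra of germs. -/
def partialDer (i : Fin n) : Derivation ℂ (HolGerm p) (HolGerm p) :=
  Derivation.mk'
    { toFun := partialGerm i
      map_add' := partialGerm_add i
      map_smul' := fun c φ => by
        rw [Algebra.smul_def, partialGerm_mul, partialGerm_algebraMap, mul_zero, add_zero,
          RingHom.id_apply, Algebra.smul_def] }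
    (partialGerm_mul i)

theorem partialDer_apply (i : Fin n) (φ : HolGerm p) : partialDer i φ = partialGerm i φ := rfl

end Germs

/-! ### Restriction of germs to `x₁ = ⋯ = xₘ = 0` -/

section Restriction

variable {m r : ℕ} {p : Fin r → ℂ}

/-- The inclusion of the subspace `x₁ = ⋯ = xₘ = 0`, as a continuous linear map. -/
def inclL (m r : ℕ) : (Fin r → ℂ) →L[ℂ] (Fin (m + r) → ℂ) where
  toFun := incl m
  map_add' x y := by
    ext i; refine Fin.addCases (fun i => ?_) (fun i => ?_) i <;> simp [incl]
  map_smul' c x := by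
    ext i; refine Fin.addCases (fun i => ?_) (fun i => ?_) i <;> simp [incl]
  cont := continuous_incl m r

theorem inclL_apply (x : Fin r → ℂ) : inclL m r x = incl m x := rfl

theorem analyticAt_comp_incl {f : (Fin (m + r) → ℂ) → ℂ} (hf : AnalyticAt ℂ f (incl m p)) :
    AnalyticAt ℂ (fun x => f (incl m x)) p :=
  AnalyticAt.comp (g := f) (f := inclL m r) hf ((inclL m r).analyticAt p)

/-- The restriction of a germ to the subspace `x₁ = ⋯ = xₘ = 0`. -/
def restr (m : ℕ) {r : ℕ} (p : Fin r → ℂ) : HolGerm (incl m p) →ₐ[ℂ] HolGerm p where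
  toFun φ := ⟨φ.1.compTendsto (incl m) (continuous_incl m r).continuousAt, by
    obtain ⟨_, f, hf, rfl⟩ := φ
    exact ⟨fun x => f (incl m x), analyticAt_comp_incl hf, rfl⟩⟩
  map_one' := rfl
  map_zero' := rfl
  map_mul' := by
    rintro ⟨_, f, hf, rfl⟩ ⟨_, g, hg, rfl⟩
    rfl
  map_add' := by
    rintro ⟨_, f, hf, rfl⟩ ⟨_, g, hg, rfl⟩
    rfl
  commutes' _ := rfl

theorem restr_germ {f : (Fin (m + r) → ℂ) → ℂ} (hf : AnalyticAt ℂ f (incl m p)) :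
    restr m p (germ f hf) = germ (fun x => f (incl m x)) (analyticAt_comp_incl hf) := rfl

theorem restr_pull (φ : HolGerm p) : restr m p (pull m φ) = φ := by
  obtain ⟨f, hf, rfl⟩ := exists_eq_germ φ
  refine germ_eq_germ (hf := analyticAt_comp_incl (analyticAt_comp_projL m
    (by rwa [projL_incl]))) (hg := hf) (Eventually.of_forall fun x => ?_)
  simp [projL_incl]

theorem restr_partialGerm (j : Fin r) (φ : HolGerm (incl m p)) :
    restr m p (partialGerm (Fin.natAdd m j) φ) = partialGerm j (restr m p φ) := by
  obtain ⟨f, hf, rfl⟩ := exists_eq_germ φ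
  refine germ_eq_germ (hf := analyticAt_comp_incl (analyticAt_partialFun _ hf))
    (hg := analyticAt_partialFun j (analyticAt_comp_incl hf)) ?_
  filter_upwards [(continuous_incl m r).continuousAt.eventually hf.eventually_analyticAt] with x hx
  have h : HasFDerivAt (fun y => f (inclL m r y))
      ((fderiv ℂ f (incl m x)).comp (inclL m r)) x :=
    HasFDerivAt.comp x hx.differentiableAt.hasFDerivAt (inclL m r).hasFDerivAt
  change fderiv ℂ f (incl m x) _ = fderiv ℂ (fun y => f (inclL m r y)) x _
  rw [h.fderiv, ContinuousLinearMap.comp_apply]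
  congr 1
  ext i
  refine Fin.addCases (fun i => ?_) (fun i => ?_) i
  · have : Fin.castAdd r i ≠ Fin.natAdd m j := by
      intro h; have := congrArg Fin.val h; simp at this; omega
    simp [inclL_apply, incl, this]
  · simp [inclL_apply, incl, Pi.single_apply]

theorem restr_coord_castAdd (i : Fin m) :
    restr m p (coord (Fin.castAdd r i)) = 0 := by
  refine germ_eq_germ (hf := analyticAt_comp_incl (analyticAt_coord _ _)) (hg := analyticAt_const)
    (Eventually.of_forall fun x => ?_)
  simp [incl]

theorem restr_coord_natAdd (j : Fin r) :
    restr m p (coord (Fin.natAdd m j)) = coord j := by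
  refine germ_eq_germ (hf := analyticAt_comp_incl (analyticAt_coord _ _))
    (hg := analyticAt_coord _ _)
    (Eventually.of_forall fun x => ?_)
  simp [incl]

theorem pull_coord (j : Fin r) :
    pull m (coord j : HolGerm p) = coord (Fin.natAdd m j) := rfl

/-- A germ differs from its restriction by a combination of the first coordinates. -/
theorem exists_eq_pull_restr_add (φ : HolGerm (incl m p)) :
    ∃ C : Fin m → HolGerm (incl m p),
      φ = pull m (restr m p φ) + ∑ i, coord (Fin.castAdd r i) * C i := by
  obtain ⟨f, hf, rfl⟩ := exists_eq_germ φ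
  -- `π` sets the first `m` coordinates to zero; it has norm at most one for the sup norm and fixes
  -- the base point.
  set π : (Fin (m + r) → ℂ) →L[ℂ] (Fin (m + r) → ℂ) := (inclL m r).comp (projL m r) with hπdef
  have hπa : ∀ x i, π x (Fin.castAdd r i) = 0 := by
    intro x i; simp [hπdef, inclL_apply, incl]
  have hπb : ∀ x j, π x (Fin.natAdd m j) = x (Fin.natAdd m j) := by
    intro x j; simp [hπdef, inclL_apply, incl, projL]
  have hπ : ‖π‖ ≤ 1 := by
    refine ContinuousLinearMap.opNorm_le_bound _ zero_le_one fun x => ?_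
    rw [one_mul, pi_norm_le_iff_of_nonneg (norm_nonneg _)]
    intro i
    refine Fin.addCases (fun i => ?_) (fun i => ?_) i
    · rw [hπa]; simp
    · rw [hπb]; exact norm_le_pi_norm x _
  have hx : π (incl m p) = incl m p := by
    simp [hπdef, projL_incl, inclL_apply]
  obtain ⟨G, hG, h⟩ := exists_analyticAt_hadamard hf hπ hx
  have hGi : ∀ i : Fin m, AnalyticAt ℂ (fun x => G x (Pi.single (Fin.castAdd r i) 1)) (incl m p) :=
    fun i => ((ContinuousLinearMap.apply ℂ ℂ
      (Pi.single (Fin.castAdd r i) 1 : Fin (m + r) → ℂ)).analyticAt _).comp hG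
  refine ⟨fun i => germ _ (hGi i), ?_⟩
  have hsum : ∑ i, coord (Fin.castAdd r i) * germ _ (hGi i) = _ :=
    sum_germ Finset.univ fun i => (analyticAt_coord (Fin.castAdd r i) _).mul (hGi i)
  rw [hsum]
  refine germ_eq_germ (hf := hf) (hg := (analyticAt_comp_projL m
    (by rw [projL_incl]; exact analyticAt_comp_incl hf)).add (Finset.analyticAt_fun_sum _
      fun i _ => (analyticAt_coord (Fin.castAdd r i) _).mul (hGi i))) ?_
  filter_upwards [h] with y hy
  change f y = f (π y) + _
  rw [← sub_eq_iff_eq_add', hy]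
  -- Only the first `m` coordinates survive in `y - π y`, so the values of the linear form `G y` on
  -- the first `m` basis vectors are the cofactors.
  have : y - π y = ∑ i : Fin m, y (Fin.castAdd r i) •
      (Pi.single (Fin.castAdd r i) 1 : Fin (m + r) → ℂ) := by
    ext i
    refine Fin.addCases (fun i => ?_) (fun i => ?_) i
    · simp [hπa, Finset.sum_apply, Pi.single_apply]
    · have : ∀ k : Fin m, Fin.natAdd m i ≠ Fin.castAdd r k := by
        intro k h; have := congrArg Fin.val h; simp at this; omega
      simp [hπb, Finset.sum_apply, this]
  conv_lhs => rw [this]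
  simp

end Restriction

/-! ### The action of differential operators on `𝒪[X]` by `∂ᵢ ↦ ∂ᵢ + X ^ aᵢ` -/

section Action

open Polynomial

variable {n : ℕ} {p : Fin n → ℂ}

theorem DStalk.induction {motive : DStalk p → Prop}
    (const : ∀ c, motive (algebraMap ℂ _ c)) (fn : ∀ f, motive (fn f)) (pd : ∀ i, motive (pd i))
    (add : ∀ P Q, motive P → motive Q → motive (P + Q))
    (mul : ∀ P Q, motive P → motive Q → motive (P * Q)) (P : DStalk p) : motive P := by
  obtain ⟨x, rfl⟩ := DStalk.mk_surjective p P
  induction x using FreeAlgebra.induction with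
  | grade0 c => rw [AlgHom.commutes]; exact const c
  | grade1 y =>
    rcases y with f | j
    · exact fn f
    · exact pd j
  | mul x y hx hy => rw [map_mul]; exact mul _ _ hx hy
  | add x y hx hy => rw [map_add]; exact add _ _ hx hy

/-- The partial derivative, applied to the coefficients of a polynomial over `𝒪`. -/
def coeffPartial (i : Fin n) : (HolGerm p)[X] →ₗ[ℂ] (HolGerm p)[X] :=
  Polynomial.lsum fun l => ((monomial l).restrictScalars ℂ) ∘ₗ (partialDer i).toLinearMap

theorem coeff_coeffPartial (i : Fin n) (g : (HolGerm p)[X]) (l : ℕ) :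
    (coeffPartial i g).coeff l = partialDer i (g.coeff l) := by
  induction g using Polynomial.induction_on' with
  | add g h hg hh => simp [hg, hh]
  | monomial k f =>
    rw [coeffPartial, Polynomial.lsum_apply, Polynomial.sum_monomial_index]
    · simp only [LinearMap.comp_apply, LinearMap.restrictScalars_apply, coeff_monomial]
      split_ifs <;> simp
    · simp

theorem coeffPartial_C_mul (i : Fin n) (f : HolGerm p) (g : (HolGerm p)[X]) :
    coeffPartial i (C f * g) = C f * coeffPartial i g + C (partialGerm i f) * g := by
  ext1 l
  simp only [coeff_coeffPartial, coeff_C_mul, coeff_add, Derivation.leibniz, smul_eq_mul,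
    partialDer_apply]
  ring

theorem coeffPartial_X_pow_mul (i : Fin n) (k : ℕ) (g : (HolGerm p)[X]) :
    coeffPartial i (X ^ k * g) = X ^ k * coeffPartial i g := by
  ext1 l
  simp only [coeff_coeffPartial, coeff_X_pow_mul']
  split_ifs <;> simp

theorem coeffPartial_comm (i j : Fin n) (g : (HolGerm p)[X]) :
    coeffPartial i (coeffPartial j g) = coeffPartial j (coeffPartial i g) := by
  ext1 l
  simp only [coeff_coeffPartial, partialDer_apply]
  exact partialGerm_comm i j _

theorem coeffPartial_derivative (i : Fin n) (g : (HolGerm p)[X]) :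
    coeffPartial i (derivative g) = derivative (coeffPartial i g) := by
  ext1 l
  simp only [coeff_coeffPartial, coeff_derivative, Derivation.leibniz, smul_eq_mul]
  rw [show ((l : HolGerm p) + 1) = ((l + 1 : ℕ) : HolGerm p) by push_cast; rfl,
    Derivation.map_natCast, mul_zero, zero_add, mul_comm]

/-- The action of `𝒟` on `𝒪[X]` such that `∂ᵢ` acts as `∂ᵢ + X ^ aᵢ`. -/
def act (a : Fin n → ℕ) (p : Fin n → ℂ) : DStalk p →ₐ[ℂ] Module.End ℂ (HolGerm p)[X] :=
  DStalk.lift (B := Module.End ℂ (HolGerm p)[X]) (fun f => LinearMap.mulLeft ℂ (C f))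
    (fun i => LinearMap.mulLeft ℂ (X ^ a i) + coeffPartial i)
    (fun f g => by ext1 h; simp [add_mul])
    (fun f g => by ext1 h; simp)
    (fun c => by
      ext1 h
      rw [LinearMap.mulLeft_apply, Module.algebraMap_end_apply, ← algebraMap_holGerm,
        ← Polynomial.algebraMap_apply, Algebra.smul_def])
    (fun i j => by
      ext1 h
      simp only [Module.End.mul_apply, LinearMap.add_apply, LinearMap.mulLeft_apply, map_add,
        coeffPartial_X_pow_mul, coeffPartial_comm i j]
      ring)
    (fun i f => by
      ext1 h
      simp only [Module.End.mul_apply, LinearMap.add_apply, LinearMap.mulLeft_apply,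
        coeffPartial_C_mul]
      ring)

variable (a : Fin n → ℕ)

theorem act_fn (f : HolGerm p) (g : (HolGerm p)[X]) : act a p (fn f) g = C f * g :=
  LinearMap.congr_fun (DStalk.lift_mk _ _ _ _ _ _ _ (Sum.inl f)) g

theorem act_pd (i : Fin n) (g : (HolGerm p)[X]) :
    act a p (pd i) g = X ^ a i * g + coeffPartial i g :=
  LinearMap.congr_fun (DStalk.lift_mk _ _ _ _ _ _ _ (Sum.inr i)) g

theorem act_mul (P Q : DStalk p) (g : (HolGerm p)[X]) :
    act a p (P * Q) g = act a p P (act a p Q g) := by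
  rw [map_mul, Module.End.mul_apply]

theorem act_algebraMap (c : ℂ) (g : (HolGerm p)[X]) :
    act a p (algebraMap ℂ _ c) g = c • g := by
  rw [AlgHom.commutes, Module.algebraMap_end_apply]

/-- `X` is a constant for the differentiations. As a power of a derivative of weight one sends `1`
to the same power of `X`, this computes the image of `P ∂₁ ^ k`. -/
theorem act_X_pow_mul (P : DStalk p) (k : ℕ) (g : (HolGerm p)[X]) :
    act a p P (X ^ k * g) = X ^ k * act a p P g := by
  induction P using DStalk.induction generalizing g with
  | const c => simp
  | fn f => rw [act_fn, act_fn]; ring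
  | pd i => rw [act_pd, act_pd, coeffPartial_X_pow_mul]; ring
  | add P Q hP hQ => simp [hP, hQ, mul_add]
  | mul P Q hP hQ => rw [act_mul, act_mul, hQ, hP]

theorem coeffPartial_X_pow (i : Fin n) (k : ℕ) : coeffPartial i (X ^ k : (HolGerm p)[X]) = 0 := by
  ext1 l
  rw [coeff_coeffPartial, coeff_X_pow]
  split_ifs <;> simp

theorem act_pd_pow_X_pow (i : Fin n) (u k : ℕ) :
    act a p (pd i ^ u) (X ^ k) = X ^ (a i * u + k) := by
  induction u with
  | zero => simp
  | succ u ih =>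
    rw [pow_succ', act_mul, ih, act_pd, coeffPartial_X_pow]
    ring

theorem act_pdPow_one (u : Fin n → ℕ) :
    act a p (pdPow u) 1 = X ^ (∑ i, a i * u i) := by
  have key : ∀ L : List (Fin n), act a p ((L.map fun i => (pd i : DStalk p) ^ u i).prod) 1 =
      X ^ ((L.map fun i => a i * u i).sum) := by
    intro L
    induction L with
    | nil => simp
    | cons i L ih => rw [List.map_cons, List.prod_cons, act_mul, ih, act_pd_pow_X_pow]; simp
  have h := key (List.finRange n)
  rw [← List.ofFn_eq_map, ← List.ofFn_eq_map, List.sum_ofFn] at h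
  exact h

/-- A monomial in the derivatives sends `1` to `X` to the power of its weight, and the two monomials
of a toric binomial have equal weights. -/
theorem act_box_one {A : Fin n → ℤ} (hA : ∀ i, A i = a i) {u : Fin n → ℤ}
    (hu : ∑ j, A j * u j = 0) : act a p (box u) 1 = 0 := by
  have h : ∑ i, a i * (u i).toNat = ∑ i, a i * (-u i).toNat := by
    zify
    rw [← sub_eq_zero, ← Finset.sum_sub_distrib, ← hu]
    refine Finset.sum_congr rfl fun i _ => ?_
    rw [← mul_sub, hA]
    congr 1
    omega
  rw [box, map_sub, LinearMap.sub_apply, act_pdPow_one, act_pdPow_one, h, sub_self]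

/-- Right multiplication by the Euler operator, on `𝒪[X]`. -/
def eulerEnd (a : Fin n → ℕ) (β : ℂ) (p : Fin n → ℂ) : Module.End ℂ (HolGerm p)[X] :=
  ∑ j, LinearMap.mulLeft ℂ (C ((a j : HolGerm p) * coord j) * X ^ a j) +
    LinearMap.mulLeft ℂ X ∘ₗ (derivative : (HolGerm p)[X] →ₗ[HolGerm p] _).restrictScalars ℂ -
    algebraMap ℂ _ β

theorem eulerEnd_apply (β : ℂ) (g : (HolGerm p)[X]) :
    eulerEnd a β p g = ∑ j, C ((a j : HolGerm p) * coord j) * X ^ a j * g +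
      X * derivative g - β • g := by
  simp only [eulerEnd, LinearMap.sub_apply, LinearMap.add_apply, LinearMap.sum_apply,
    LinearMap.mulLeft_apply, LinearMap.comp_apply, LinearMap.restrictScalars_apply,
    Module.algebraMap_end_apply]

/-- `X d/dX` picks up `k` when it passes `X ^ k`; this is the source of the parameter shift `β - k`.
-/
theorem eulerEnd_X_pow_mul (β : ℂ) (k : ℕ) (g : (HolGerm p)[X]) :
    eulerEnd a β p (X ^ k * g) = X ^ k * eulerEnd a (β - k) p g := by
  have h : X * derivative (X ^ k * g) = X ^ k * (X * derivative g + (k : ℂ) • g) := by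
    rw [derivative_mul, derivative_X_pow, Nat.cast_smul_eq_nsmul, nsmul_eq_mul, C_eq_natCast]
    rcases k with _ | k
    · simp
    · rw [Nat.add_sub_cancel, pow_succ]; ring
  rw [eulerEnd_apply, eulerEnd_apply, h, sub_smul, mul_sub, mul_sub, mul_add, mul_add,
    Finset.mul_sum, ← mul_smul_comm]
  rw [show ∑ j, C ((a j : HolGerm p) * coord j) * X ^ a j * (X ^ k * g) =
    ∑ j, X ^ k * (C ((a j : HolGerm p) * coord j) * X ^ a j * g) from
      Finset.sum_congr rfl fun j _ => by ring]
  ring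

/-- Right multiplication by the Euler operator is `𝒟`-linear. -/
theorem eulerEnd_act (β : ℂ) (P : DStalk p) (g : (HolGerm p)[X]) :
    eulerEnd a β p (act a p P g) = act a p P (eulerEnd a β p g) := by
  induction P using DStalk.induction generalizing g with
  | const c => simp
  | fn f =>
    rw [act_fn, act_fn, eulerEnd_apply, eulerEnd_apply, derivative_C_mul, mul_sub, mul_add,
      Finset.mul_sum, ← mul_smul_comm]
    rw [show ∑ j, C ((a j : HolGerm p) * coord j) * X ^ a j * (C f * g) =
      ∑ j, C f * (C ((a j : HolGerm p) * coord j) * X ^ a j * g) from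
        Finset.sum_congr rfl fun j _ => by ring]
    ring
  | pd i =>
    -- The shift by `a i` from moving past `X ^ a i` is matched by the derivative of the coefficient
    -- `a i xᵢ`.
    rw [act_pd, act_pd, map_add, eulerEnd_X_pow_mul]
    have h : coeffPartial i (∑ j, C ((a j : HolGerm p) * coord j) * X ^ a j * g) =
        ∑ j, C ((a j : HolGerm p) * coord j) * X ^ a j * coeffPartial i g +
          (a i : ℂ) • (X ^ a i * g) := by
      have h1 : ∀ j, coeffPartial i (C ((a j : HolGerm p) * coord j) * X ^ a j * g) =
          C ((a j : HolGerm p) * coord j) * X ^ a j * coeffPartial i g +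
            if i = j then (a j : ℂ) • (X ^ a j * g) else 0 := by
        intro j
        have h2 : partialGerm i ((a j : HolGerm p) * coord j) =
            if i = j then (a j : HolGerm p) else 0 := by
          rw [partialGerm_mul, partialGerm_coord,
            show partialGerm i (a j : HolGerm p) = 0 from (partialDer i).map_natCast _]
          simp
        rw [mul_assoc, coeffPartial_C_mul, coeffPartial_X_pow_mul, h2, mul_assoc]
        congr 1
        split_ifs
        · rw [Nat.cast_smul_eq_nsmul, nsmul_eq_mul, C_eq_natCast]
        · simp
      rw [map_sum, Finset.sum_congr rfl fun j _ => h1 j, Finset.sum_add_distrib,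
        Finset.sum_ite_eq]
      simp
    have h3 : coeffPartial i (X * derivative g) = X * derivative (coeffPartial i g) := by
      have := coeffPartial_X_pow_mul i 1 (derivative g)
      rwa [pow_one, coeffPartial_derivative] at this
    rw [eulerEnd_apply, eulerEnd_apply a β g, eulerEnd_apply, map_sub, map_add, h, h3, map_smul,
      sub_smul]
    simp only [mul_sub, mul_add, mul_smul_comm]
    abel
  | add P Q hP hQ => simp only [map_add, LinearMap.add_apply, hP, hQ]
  | mul P Q hP hQ => rw [act_mul, act_mul, hP, hQ]

theorem act_euler_one {A : Fin n → ℤ} (hA : ∀ i, A i = a i) (β : ℂ) :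
    act a p (euler A β) 1 = eulerEnd a β p 1 := by
  rw [euler, map_sub, map_sum, LinearMap.sub_apply, LinearMap.sum_apply, act_algebraMap,
    eulerEnd_apply]
  have h1 : ∀ j, act a p ((A j : ℂ) • (fn (coord j) * pd j)) 1 =
      C ((a j : HolGerm p) * coord j) * X ^ a j * 1 := by
    intro j
    have h0 := coeffPartial_X_pow (p := p) j 0
    rw [pow_zero] at h0
    rw [map_smul, LinearMap.smul_apply, act_mul, act_pd, act_fn, hA, h0]
    rw [Int.cast_natCast, Nat.cast_smul_eq_nsmul, nsmul_eq_mul, C_mul, C_eq_natCast]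
    ring
  rw [Finset.sum_congr rfl fun j _ => h1 j]
  simp

/-- The image of the 𝒟-linear `eulerEnd` is stable under 𝒟, and it contains the images of all
generators of the ideal. -/
theorem act_hypIdeal_one {A : Fin n → ℤ} (hA : ∀ i, A i = a i) (β : ℂ) {P : DStalk p}
    (hP : P ∈ hypIdeal A β p) : ∃ g, act a p P 1 = eulerEnd a β p g := by
  induction hP using Submodule.span_induction with
  | mem x hx =>
    rcases hx with ⟨u, hu, rfl⟩ | rfl
    · exact ⟨0, by rw [act_box_one a hA hu, map_zero]⟩
    · exact ⟨1, act_euler_one a hA β⟩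
  | zero => exact ⟨0, by simp⟩
  | add x y _ _ hx hy =>
    obtain ⟨g, hg⟩ := hx
    obtain ⟨h, hh⟩ := hy
    exact ⟨g + h, by rw [map_add, LinearMap.add_apply, hg, hh, map_add]⟩
  | smul Q x _ hx =>
    obtain ⟨g, hg⟩ := hx
    exact ⟨act a p Q g, by rw [smul_eq_mul, act_mul, hg, eulerEnd_act]⟩

end Action

/-! ### Normal forms of differential operators -/

section NormalForm

variable {n : ℕ} {p : Fin n → ℂ}

/-- The Leibniz rule moves all functions to the left. -/
theorem closure_fn_mul_word (P : DStalk p) :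
    P ∈ AddSubmonoid.closure {Q : DStalk p | ∃ f w, Q = fn f * (List.map pd w).prod} := by
  set N := AddSubmonoid.closure {Q : DStalk p | ∃ f w, Q = fn f * (List.map pd w).prod}
  have hfn : ∀ f, ∀ Q ∈ N, fn f * Q ∈ N := by
    intro f Q hQ
    induction hQ using AddSubmonoid.closure_induction with
    | mem x hx =>
      obtain ⟨g, w, rfl⟩ := hx
      exact AddSubmonoid.subset_closure ⟨f * g, w, by rw [fn_mul, mul_assoc]⟩
    | zero => rw [mul_zero]; exact zero_mem _
    | add x y _ _ hx hy => rw [mul_add]; exact add_mem hx hy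
  have key : ∀ P : DStalk p, ∀ Q ∈ N, P * Q ∈ N := by
    intro P
    induction P using DStalk.induction with
    | const c => rw [← fn_const]; exact hfn _
    | fn f => exact hfn f
    | pd i =>
      intro Q hQ
      induction hQ using AddSubmonoid.closure_induction with
      | mem x hx =>
        obtain ⟨g, w, rfl⟩ := hx
        rw [← mul_assoc, pd_fn, add_mul, mul_assoc]
        exact add_mem (AddSubmonoid.subset_closure ⟨g, i :: w, by simp⟩)
          (AddSubmonoid.subset_closure ⟨partialGerm i g, w, rfl⟩)
      | zero => rw [mul_zero]; exact zero_mem _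
      | add x y _ _ hx hy => rw [mul_add]; exact add_mem hx hy
    | add P Q hP hQ => intro R hR; rw [add_mul]; exact add_mem (hP R hR) (hQ R hR)
    | mul P Q hP hQ => intro R hR; rw [mul_assoc]; exact hP _ (hQ R hR)
  have h1 : (1 : DStalk p) ∈ N := AddSubmonoid.subset_closure
    ⟨constGerm 1, [], by rw [fn_const, map_one]; simp⟩
  simpa using key P 1 h1

/-- The normal form again, now with coefficients holomorphic on all of `V`; this is needed to find
generators of sections and not only of germs. -/
theorem DPre_le_closure {V : Opens (Fin n → ℂ)} {P : ∀ q : V, DStalk q.1} (hP : P ∈ DPre V) :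
    P ∈ AddSubmonoid.closure {Q : ∀ q : V, DStalk q.1 | ∃ (f : (Fin n → ℂ) → ℂ)
      (hf : ∀ q : V, AnalyticAt ℂ f q.1) (w : List (Fin n)),
        Q = fun q => fn (germ f (hf q)) * (List.map pd w).prod} := by
  set N := AddSubmonoid.closure {Q : ∀ q : V, DStalk q.1 | ∃ (f : (Fin n → ℂ) → ℂ)
      (hf : ∀ q : V, AnalyticAt ℂ f q.1) (w : List (Fin n)),
        Q = fun q => fn (germ f (hf q)) * (List.map pd w).prod}
  have hfn : ∀ (f : (Fin n → ℂ) → ℂ) (hf : ∀ q : V, AnalyticAt ℂ f q.1), ∀ Q ∈ N,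
      (fun q => fn (germ f (hf q))) * Q ∈ N := by
    intro f hf Q hQ
    induction hQ using AddSubmonoid.closure_induction with
    | mem x hx =>
      obtain ⟨g, hg, w, rfl⟩ := hx
      refine AddSubmonoid.subset_closure ⟨f * g, fun q => (hf q).mul (hg q), w, ?_⟩
      funext q
      rw [Pi.mul_apply, ← mul_assoc, ← fn_mul]
      rfl
    | zero => rw [mul_zero]; exact zero_mem _
    | add x y _ _ hx hy => rw [mul_add]; exact add_mem hx hy
  have key : ∀ Q ∈ N, P * Q ∈ N := by
    induction hP using Algebra.adjoin_induction with
    | mem x hx =>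
      rcases hx with ⟨f, hf, rfl⟩ | ⟨i, rfl⟩
      · exact hfn f hf
      · intro Q hQ
        induction hQ using AddSubmonoid.closure_induction with
        | mem x hx =>
          obtain ⟨g, hg, w, rfl⟩ := hx
          have e : ((fun _ : V => pd i) * fun q : V => fn (germ g (hg q)) * (List.map pd w).prod :
              ∀ q : V, DStalk q.1) =
              (fun q : V => fn (germ g (hg q)) * (List.map pd (i :: w)).prod) +
              fun q : V => fn (germ (partialFun i g) (analyticAt_partialFun i (hg q))) *
                (List.map pd w).prod := by
            funext q
            rw [Pi.mul_apply, Pi.add_apply, ← mul_assoc, pd_fn, add_mul, mul_assoc, List.map_cons,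
              List.prod_cons]
            rfl
          rw [e]
          exact add_mem (AddSubmonoid.subset_closure ⟨g, hg, i :: w, rfl⟩)
            (AddSubmonoid.subset_closure ⟨_, fun q => analyticAt_partialFun i (hg q), w, rfl⟩)
        | zero => rw [mul_zero]; exact zero_mem _
        | add x y _ _ hx hy => rw [mul_add]; exact add_mem hx hy
    | algebraMap c =>
      have e : (algebraMap ℂ (∀ q : V, DStalk q.1) c) =
          fun q : V => fn (germ (fun _ => c) analyticAt_const) := by
        funext q
        exact (fn_const c).symm
      rw [e]
      exact hfn (fun _ => c) fun _ => analyticAt_const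
    | add P Q _ _ hP hQ => intro R hR; rw [add_mul]; exact add_mem (hP R hR) (hQ R hR)
    | mul P Q _ _ hP hQ => intro R hR; rw [mul_assoc]; exact hP _ (hQ R hR)
  have h1 : (1 : ∀ q : V, DStalk q.1) ∈ N := by
    refine AddSubmonoid.subset_closure ⟨fun _ => 1, fun _ => analyticAt_const, [], ?_⟩
    funext q
    have := fn_const (p := q.1) 1
    rw [map_one] at this
    rw [List.map_nil, List.prod_nil, mul_one]
    exact this.symm
  simpa using key 1 h1

theorem pd_commute (i j : Fin n) : Commute (pd i : DStalk p) (pd j) := pd_comm i j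

theorem pdPow_single (j : Fin n) (k : ℕ) : pdPow (p := p) (Pi.single j k) = pd j ^ k := by
  have key : ∀ L : List (Fin n), L.Nodup →
      (L.map fun i => (pd i : DStalk p) ^ (Pi.single j k : Fin n → ℕ) i).prod =
        if j ∈ L then pd j ^ k else 1 := by
    intro L hL
    induction L with
    | nil => simp
    | cons i L ih =>
      rw [List.nodup_cons] at hL
      rw [List.map_cons, List.prod_cons, ih hL.2]
      by_cases hij : i = j
      · subst hij; simp [hL.1]
      · simp [hij, Ne.symm hij]
  have h := key (List.finRange n) (List.nodup_finRange n)
  rw [← List.ofFn_eq_map] at h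
  simpa [pdPow] using h

end NormalForm

/-! ### Hypergeometric systems of two positive integers -/

section TwoVariables

open Polynomial

variable {p : Fin 2 → ℂ} (a : Fin 2 → ℕ)

/-- `l` lies in the semigroup generated by `a₀` and `a₁`. -/
def IsComb (l : ℕ) : Prop := ∃ u v, l = a 0 * u + a 1 * v

theorem pd_pow_mul_pd_pow_mul (u v u' v' : ℕ) :
    (pd 0 ^ u * pd 1 ^ v * (pd 0 ^ u' * pd 1 ^ v') : DStalk p) =
      pd 0 ^ (u + u') * pd 1 ^ (v + v') := by
  rw [mul_assoc, ← mul_assoc (pd 1 ^ v), ((pd_commute 1 0).pow_pow v u').eq, pow_add, pow_add]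
  simp only [mul_assoc]

theorem exists_word_eq (w : List (Fin 2)) :
    ∃ u v, (List.map pd w).prod = (pd 0 ^ u * pd 1 ^ v : DStalk p) := by
  induction w with
  | nil => exact ⟨0, 0, by simp⟩
  | cons i w ih =>
    obtain ⟨u, v, h⟩ := ih
    rw [List.map_cons, List.prod_cons, h]
    fin_cases i
    · exact ⟨u + 1, v, by rw [pow_succ', mul_assoc]; rfl⟩
    · refine ⟨u, v + 1, ?_⟩
      have := pd_pow_mul_pd_pow_mul (p := p) 0 1 u v
      simpa [add_comm] using this

theorem closure_fn_mul_pd_pow (P : DStalk p) :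
    P ∈ AddSubmonoid.closure {Q : DStalk p | ∃ f u v, Q = fn f * (pd 0 ^ u * pd 1 ^ v)} := by
  refine AddSubmonoid.closure_mono ?_ (closure_fn_mul_word P)
  rintro _ ⟨f, w, rfl⟩
  obtain ⟨u, v, h⟩ := exists_word_eq (p := p) w
  exact ⟨f, u, v, by rw [h]⟩

theorem act_fn_mul_pd_pow (f : HolGerm p) (u v : ℕ) :
    act a p (fn f * (pd 0 ^ u * pd 1 ^ v)) 1 = monomial (a 0 * u + a 1 * v) f := by
  have h := act_pd_pow_X_pow a (p := p) 1 v 0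
  rw [pow_zero] at h
  rw [act_mul, act_mul, h, act_pd_pow_X_pow, act_fn, add_zero, C_mul_X_pow_eq_monomial]

/-- Every operator is a sum of terms `f ∂₀^u ∂₁^v`, each of which sends `1` to a monomial whose
exponent is in the semigroup. -/
theorem isComb_of_coeff_act_ne_zero (P : DStalk p) (l : ℕ) (h : (act a p P 1).coeff l ≠ 0) :
    IsComb a l := by
  by_contra hl
  apply h
  induction closure_fn_mul_pd_pow P using AddSubmonoid.closure_induction with
  | mem x hx =>
    obtain ⟨f, u, v, rfl⟩ := hx
    rw [act_fn_mul_pd_pow, coeff_monomial, if_neg]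
    rintro rfl
    exact hl ⟨u, v, rfl⟩
  | zero => simp
  | add x y _ _ hx hy =>
    rw [map_add, LinearMap.add_apply, coeff_add]
    by_cases h1 : (act a p x 1).coeff l = 0
    · by_cases h2 : (act a p y 1).coeff l = 0
      · rw [h1, h2, add_zero]
      · exact absurd (hy h2) h2
    · exact absurd (hx h1) h1

/-! ### Toric relations and the annihilator of 1 -/

variable {a} {A : Fin 2 → ℤ}

/-- After the common factor of the two monomials is split off, a toric binomial remains. -/
theorem pd_pow_sub_mem_hypIdeal (hA : ∀ i, A i = a i) (β : ℂ) {u v u' v' : ℕ}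
    (h : a 0 * u + a 1 * v = a 0 * u' + a 1 * v') :
    (pd 0 ^ u * pd 1 ^ v - pd 0 ^ u' * pd 1 ^ v' : DStalk p) ∈ hypIdeal A β p := by
  have hbox : (box ![(u : ℤ) - u', (v : ℤ) - v'] : DStalk p) ∈ hypIdeal A β p := by
    refine Submodule.subset_span (Or.inl ⟨_, ?_, rfl⟩)
    rw [Fin.sum_univ_two, hA, hA]
    simp only [Matrix.cons_val_zero, Matrix.cons_val_one]
    zify at h
    linear_combination h
  have hb : (box ![(u : ℤ) - u', (v : ℤ) - v'] : DStalk p) =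
      pd 0 ^ (u - u') * pd 1 ^ (v - v') - pd 0 ^ (u' - u) * pd 1 ^ (v' - v) := by
    simp [box, pdPow, List.ofFn_succ]
  have := Submodule.smul_mem _ (pd 0 ^ (min u u') * pd 1 ^ (min v v') : DStalk p) hbox
  rw [hb, smul_eq_mul, mul_sub, pd_pow_mul_pd_pow_mul, pd_pow_mul_pd_pow_mul] at this
  convert this using 4 <;> omega

open Classical in
/-- A monomial in `∂₀, ∂₁` of weight `l`, if there is one. -/
def combMon (a : Fin 2 → ℕ) (p : Fin 2 → ℂ) (l : ℕ) : DStalk p :=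
  if h : IsComb a l then pd 0 ^ h.choose * pd 1 ^ h.choose_spec.choose else 0

/-- The choice made in `combMon` is immaterial modulo the toric relations. -/
theorem pd_pow_sub_combMon_mem (hA : ∀ i, A i = a i) (β : ℂ) (u v : ℕ) :
    (pd 0 ^ u * pd 1 ^ v - combMon a p (a 0 * u + a 1 * v) : DStalk p) ∈ hypIdeal A β p := by
  have h : IsComb a (a 0 * u + a 1 * v) := ⟨u, v, rfl⟩
  rw [combMon, dif_pos h]
  exact pd_pow_sub_mem_hypIdeal hA β h.choose_spec.choose_spec

theorem fn_zero : fn (0 : HolGerm p) = 0 := by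
  have := fn_add (0 : HolGerm p) 0
  simpa using this

/-- An operator that acts trivially on `1` lies in the toric ideal. -/
theorem mem_hypIdeal_of_act_eq_zero (hA : ∀ i, A i = a i) (β : ℂ) {P : DStalk p}
    (hP : act a p P 1 = 0) : P ∈ hypIdeal A β p := by
  -- Modulo the toric relations `P` is recovered from its image of `1` by replacing each `X ^ l` by
  -- a monomial of weight `l`.
  have key : ∀ P : DStalk p,
      P - (act a p P 1).sum (fun l f => fn f * combMon a p l) ∈ hypIdeal A β p := by
    intro P
    induction closure_fn_mul_pd_pow P using AddSubmonoid.closure_induction with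
    | mem x hx =>
      obtain ⟨f, u, v, rfl⟩ := hx
      rw [act_fn_mul_pd_pow, sum_monomial_index _ _ (by rw [fn_zero, zero_mul]), ← mul_sub]
      exact Submodule.smul_mem _ (fn f) (pd_pow_sub_combMon_mem hA β u v)
    | zero => simp
    | add x y _ _ hx hy =>
      rw [map_add, LinearMap.add_apply, Polynomial.sum_add_index _ _ _
        (fun i => by rw [fn_zero, zero_mul]) (fun i f g => by rw [fn_add, add_mul]),
        add_sub_add_comm]
      exact add_mem hx hy
  simpa [hP] using key P

/-- A recursion: unless `β = l`, it determines the coefficient of `g` at `l` from the lower ones and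
the image. -/
theorem coeff_eulerEnd (β : ℂ) (g : (HolGerm p)[X]) (l : ℕ) :
    (eulerEnd a β p g).coeff l =
      (∑ j, (a j : HolGerm p) * coord j * if a j ≤ l then g.coeff (l - a j) else 0) +
        ((l : ℂ) - β) • g.coeff l := by
  have h : (X * derivative g).coeff l = (l : ℂ) • g.coeff l := by
    rw [Nat.cast_smul_eq_nsmul, nsmul_eq_mul]
    rcases l with _ | l
    · simp
    · rw [coeff_X_mul, coeff_derivative]; push_cast; ring
  rw [eulerEnd_apply, coeff_sub, coeff_add, h, coeff_smul, finsetSum_coeff, sub_smul, add_sub_assoc]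
  congr 1
  refine Finset.sum_congr rfl fun j _ => ?_
  rw [mul_assoc, coeff_C_mul, coeff_X_pow_mul']

/-! ### Polynomials supported in translates of the semigroup -/

variable {k : ℕ} {c : Fin k → ℕ} {β : ℂ}

/-- A polynomial with support in the union of the `cᵢ + S` comes from operators. -/
theorem exists_sum_X_pow_mul_act (g : (HolGerm p)[X])
    (hg : ∀ l, g.coeff l ≠ 0 → ∃ i s, IsComb a s ∧ l = c i + s) :
    ∃ G : Fin k → DStalk p, g = ∑ i, X ^ c i * act a p (G i) 1 := by
  rw [g.as_sum_support]
  refine Finset.sum_induction _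
    (fun g => ∃ G : Fin k → DStalk p, g = ∑ i, X ^ c i * act a p (G i) 1) ?_ ⟨0, by simp⟩ ?_
  · rintro _ _ ⟨G, rfl⟩ ⟨H, rfl⟩
    exact ⟨G + H, by simp [mul_add, Finset.sum_add_distrib]⟩
  · intro l hl
    obtain ⟨i, _, ⟨u, v, rfl⟩, rfl⟩ := hg l (mem_support_iff.1 hl)
    refine ⟨Pi.single i (fn (g.coeff (c i + (a 0 * u + a 1 * v))) *
      (pd 0 ^ u * pd 1 ^ v)), ?_⟩
    rw [Finset.sum_eq_single i]
    · rw [Pi.single_eq_same, act_fn_mul_pd_pow, X_pow_mul_monomial, add_comm (c i)]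
    · intro j _ hj
      rw [Pi.single_eq_of_ne hj]
      simp
    · simp

/-- The `i`-th summand is supported in `c i + S`; these sets are disjoint, so nothing can cancel. -/
theorem act_eq_zero_of_sum_eq_zero
    (hdisj : ∀ i j s t, IsComb a s → IsComb a t → c i + s = c j + t → i = j)
    (G : Fin k → DStalk p) (h : ∑ i, X ^ c i * act a p (G i) 1 = 0) (i : Fin k) :
    act a p (G i) 1 = 0 := by
  ext1 l
  by_contra hl
  rw [coeff_zero] at hl
  have hs := isComb_of_coeff_act_ne_zero a _ _ hl
  apply hl
  have h1 := congrArg (fun g => g.coeff (l + c i)) h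
  simp only [finsetSum_coeff, coeff_zero] at h1
  rw [Finset.sum_eq_single i, coeff_X_pow_mul] at h1
  · exact h1
  · intro j _ hj
    by_contra hne
    rw [coeff_X_pow_mul'] at hne
    split_ifs at hne with hle
    · exact hj (hdisj j i _ _ (isComb_of_coeff_act_ne_zero a _ _ hne) hs (by omega))
    · exact hne rfl
  · simp

/-- If the classes of `X ^ cᵢ Pᵢ` add up to zero modulo the Euler operator, then every `Pᵢ` is
in the corresponding hypergeometric ideal. -/
theorem mem_hypIdeal_of_sum_eq_eulerEnd (hA : ∀ i, A i = a i) (ha : ∀ i, 0 < a i)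
    (hdisj : ∀ i j s t, IsComb a s → IsComb a t → c i + s = c j + t → i = j)
    (hβ : ∀ l : ℕ, β = l → ∃ i s, IsComb a s ∧ l = c i + s) (P : Fin k → DStalk p)
    (g : (HolGerm p)[X]) (h : ∑ i, X ^ c i * act a p (P i) 1 = eulerEnd a β p g) (i : Fin k) :
    P i ∈ hypIdeal A (β - c i) p := by
  -- The left side of `h` has no coefficient at such `l`, and neither does `g` at `l - a j`, because
  -- the union of the `c i + S` is stable under adding `a j`. The recursion leaves `(l - β)` times
  -- the coefficient, with `l ≠ β`.
  have hsupp : ∀ l, (¬ ∃ i s, IsComb a s ∧ l = c i + s) → g.coeff l = 0 := by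
    intro l
    induction l using Nat.strong_induction_on with
    | _ l ih =>
      intro hl
      have h1 := congrArg (fun g => g.coeff l) h
      simp only [finsetSum_coeff] at h1
      rw [coeff_eulerEnd, Finset.sum_eq_zero, Finset.sum_eq_zero, zero_add] at h1
      · have hne : (l : ℂ) - β ≠ 0 := fun h0 => hl (hβ l (sub_eq_zero.1 h0).symm)
        rw [← inv_smul_smul₀ hne (g.coeff l), ← h1, smul_zero]
      · intro j _
        split_ifs with hj
        · rw [ih (l - a j) (by have := ha j; omega), mul_zero]
          rintro ⟨i, s, ⟨u, v, rfl⟩, hs⟩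
          have hl' : l = a j + (l - a j) := by omega
          rw [hs] at hl'
          refine hl ⟨i, _, ?_, hl'.trans (add_left_comm _ _ _)⟩
          fin_cases j
          · exact ⟨u + 1, v, by simp only [Fin.zero_eta]; ring⟩
          · exact ⟨u, v + 1, by simp only [Fin.mk_one]; ring⟩
        · rw [mul_zero]
      · intro j _
        by_contra hne
        rw [coeff_X_pow_mul'] at hne
        split_ifs at hne with hle
        · exact hl ⟨j, _, isComb_of_coeff_act_ne_zero a _ _ hne, by omega⟩
        · exact hne rfl
  obtain ⟨G, rfl⟩ := exists_sum_X_pow_mul_act (a := a) (c := c) g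
    fun l hl => by_contra fun h' => hl (hsupp l h')
  -- Moving `eulerEnd` past `X ^ c i` turns it into right multiplication of `G i` by the Euler
  -- operator with parameter `β - c i`.
  have h2 : ∑ i, X ^ c i * act a p (P i - G i * euler A (β - c i)) 1 = 0 := by
    simp only [map_sub, LinearMap.sub_apply, mul_sub, Finset.sum_sub_distrib, act_mul]
    rw [h, map_sum, sub_eq_zero]
    refine Finset.sum_congr rfl fun i _ => ?_
    rw [eulerEnd_X_pow_mul, eulerEnd_act, act_euler_one a hA]
  have h3 := mem_hypIdeal_of_act_eq_zero hA (β - c i)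
    (act_eq_zero_of_sum_eq_zero hdisj _ h2 i)
  have h4 : G i * euler A (β - c i) ∈ hypIdeal A (β - c i) p :=
    Submodule.smul_mem _ (G i) (Submodule.subset_span (Or.inr rfl))
  simpa using add_mem h3 h4

end TwoVariables

/-! ### The stalks of the restriction -/

section RestrictionStalk

open Polynomial

/-- Restriction of coefficients commutes with the derivatives along the subspace, so it intertwines
the two actions of 𝒟'. -/
theorem map_restr_act_extOp {m r : ℕ} {p : Fin r → ℂ} (a : Fin (m + r) → ℕ) (Q : DStalk p)
    (g : (HolGerm (incl m p))[X]) :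
    (act a (incl m p) (extOp m p Q) g).map (restr m p : HolGerm (incl m p) →+* HolGerm p) =
      act (fun j => a (Fin.natAdd m j)) p Q
        (g.map (restr m p : HolGerm (incl m p) →+* HolGerm p)) := by
  induction Q using DStalk.induction generalizing g with
  | const c =>
    rw [AlgHom.commutes, act_algebraMap, act_algebraMap]
    ext1 l
    simp
  | fn f =>
    rw [extOp_fn, act_fn, act_fn, Polynomial.map_mul, map_C]
    congr 2
    exact restr_pull f
  | pd i =>
    rw [extOp_pd, act_pd, act_pd, Polynomial.map_add, Polynomial.map_mul, Polynomial.map_pow, map_X]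
    congr 1
    ext1 l
    rw [coeff_map, coeff_coeffPartial, coeff_coeffPartial, coeff_map]
    exact restr_partialGerm i _
  | add P Q hP hQ => simp only [map_add, LinearMap.add_apply, Polynomial.map_add, hP, hQ]
  | mul P Q hP hQ => rw [map_mul, act_mul, act_mul, hP, hQ]

/-- The first `m` terms carry a coordinate that vanishes on the subspace, while `X d/dX - β` does
not involve the coordinates; hence `β` is unchanged. -/
theorem map_restr_eulerEnd {m r : ℕ} {p : Fin r → ℂ} (a : Fin (m + r) → ℕ) (β : ℂ)
    (g : (HolGerm (incl m p))[X]) :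
    (eulerEnd a β (incl m p) g).map (restr m p : HolGerm (incl m p) →+* HolGerm p) =
      eulerEnd (fun j => a (Fin.natAdd m j)) β p
        (g.map (restr m p : HolGerm (incl m p) →+* HolGerm p)) := by
  have hs : ∀ g : (HolGerm (incl m p))[X],
      (β • g).map (restr m p : HolGerm (incl m p) →+* HolGerm p) =
        β • g.map (restr m p : HolGerm (incl m p) →+* HolGerm p) := by
    intro g
    ext1 l
    simp
  rw [eulerEnd_apply, eulerEnd_apply, Polynomial.map_sub, Polynomial.map_add, hs,
    Polynomial.map_mul, map_X, derivative_map, Polynomial.map_sum, Fin.sum_univ_add]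
  have h1 : ∀ i : Fin m, (C ((a (Fin.castAdd r i) : HolGerm (incl m p)) *
      coord (Fin.castAdd r i)) * X ^ a (Fin.castAdd r i) * g).map
        (restr m p : HolGerm (incl m p) →+* HolGerm p) = 0 := by
    intro i
    rw [Polynomial.map_mul, Polynomial.map_mul, map_C, map_mul,
      show (restr m p : HolGerm (incl m p) →+* HolGerm p) (coord (Fin.castAdd r i)) = 0 from
        restr_coord_castAdd i]
    simp
  have h2 : ∀ j : Fin r, (C ((a (Fin.natAdd m j) : HolGerm (incl m p)) *
      coord (Fin.natAdd m j)) * X ^ a (Fin.natAdd m j) * g).map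
        (restr m p : HolGerm (incl m p) →+* HolGerm p) =
      C ((a (Fin.natAdd m j) : HolGerm p) * coord j) * X ^ a (Fin.natAdd m j) *
        g.map (restr m p : HolGerm (incl m p) →+* HolGerm p) := by
    intro j
    rw [Polynomial.map_mul, Polynomial.map_mul, map_C, map_mul,
      show (restr m p : HolGerm (incl m p) →+* HolGerm p) (coord (Fin.natAdd m j)) = coord j from
        restr_coord_natAdd j]
    simp
  rw [Finset.sum_congr rfl fun i _ => h1 i, Finset.sum_congr rfl fun j _ => h2 j]
  simp

theorem map_restr_act_restrSub {m r : ℕ} {p : Fin r → ℂ} {A : Fin (m + r) → ℤ}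
    {a : Fin (m + r) → ℕ} (hA : ∀ i, A i = a i) {β : ℂ} {P : DStalk (incl m p)}
    (hP : P ∈ restrSub A β p) :
    ∃ g, (act a (incl m p) P 1).map (restr m p : HolGerm (incl m p) →+* HolGerm p) =
      eulerEnd (fun j => a (Fin.natAdd m j)) β p g := by
  obtain ⟨H, hH, K, rfl⟩ := hP
  obtain ⟨g, hg⟩ := act_hypIdeal_one a hA β hH
  refine ⟨_, Eq.trans ?_ (map_restr_eulerEnd a β g)⟩
  rw [← hg, map_add, LinearMap.add_apply, Polynomial.map_add, map_sum, LinearMap.sum_apply,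
    Polynomial.map_sum]
  have h1 : ∀ i : Fin m, (act a (incl m p) (fn (coord (Fin.castAdd r i)) * K i) 1).map
      (restr m p : HolGerm (incl m p) →+* HolGerm p) = 0 := by
    intro i
    rw [act_mul, act_fn, Polynomial.map_mul, map_C,
      show (restr m p : HolGerm (incl m p) →+* HolGerm p) (coord (Fin.castAdd r i)) = 0 from
        restr_coord_castAdd i]
    simp
  rw [Finset.sum_congr rfl fun i _ => h1 i]
  simp

/-! ### Generators and relations of the restricted stalk -/

theorem smul_rStalk_mk {m r : ℕ} (A : Fin (m + r) → ℤ) (β : ℂ) {p : Fin r → ℂ} (Q : DStalk p)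
    (P : DStalk (incl m p)) : Q • RStalk.mk A β p P = RStalk.mk A β p (extOp m p Q * P) := rfl

theorem rStalk_mk_add {m r : ℕ} (A : Fin (m + r) → ℤ) (β : ℂ) {p : Fin r → ℂ}
    (P Q : DStalk (incl m p)) :
    RStalk.mk A β p (P + Q) = RStalk.mk A β p P + RStalk.mk A β p Q := rfl

theorem rStalk_mk_eq_zero {m r : ℕ} {A : Fin (m + r) → ℤ} {β : ℂ} {p : Fin r → ℂ}
    {P : DStalk (incl m p)} : RStalk.mk A β p P = 0 ↔ P ∈ restrSub A β p :=
  Submodule.Quotient.mk_eq_zero _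

theorem rStalk_mk_eq {m r : ℕ} {A : Fin (m + r) → ℤ} {β : ℂ} {p : Fin r → ℂ}
    {P Q : DStalk (incl m p)} :
    RStalk.mk A β p P = RStalk.mk A β p Q ↔ P - Q ∈ restrSub A β p :=
  Submodule.Quotient.eq _

theorem hypIdeal_le_restrSub {m r : ℕ} {A : Fin (m + r) → ℤ} {β : ℂ} {p : Fin r → ℂ}
    {P : DStalk (incl m p)} (hP : P ∈ hypIdeal A β (incl m p)) : P ∈ restrSub A β p :=
  ⟨P, hP, 0, show P = P + ∑ i, fn (coord (Fin.castAdd r i)) * (0 : DStalk (incl m p)) by simp⟩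

/-- By Hadamard's lemma `φ` and the pullback of its restriction differ by a combination of the first
coordinates, which are zero on the left of any class. -/
theorem rStalk_mk_fn_mul {m r : ℕ} (A : Fin (m + r) → ℤ) (β : ℂ) {p : Fin r → ℂ}
    (φ : HolGerm (incl m p)) (W : DStalk (incl m p)) :
    RStalk.mk A β p (fn φ * W) = fn (restr m p φ) • RStalk.mk A β p W := by
  obtain ⟨K, hK⟩ := exists_eq_pull_restr_add φ
  rw [smul_rStalk_mk, extOp_fn, rStalk_mk_eq]
  refine ⟨0, zero_mem _, fun i => fn (K i) * W, ?_⟩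
  change fn φ * W - fn (pull m (restr m p φ)) * W =
    0 + ∑ i, fn (coord (Fin.castAdd r i)) * (fn (K i) * W)
  have hsum : ∀ F : Fin m → HolGerm (incl m p), fn (∑ i, F i) = ∑ i, fn (F i) := by
    intro F
    exact map_sum (AddMonoidHom.mk' fn fn_add) F Finset.univ
  rw [sub_eq_iff_eq_add', zero_add]
  conv_lhs => rw [hK]
  rw [fn_add, add_mul, hsum, Finset.sum_mul]
  congr 1
  exact Finset.sum_congr rfl fun i _ => by rw [fn_mul, mul_assoc]

variable {m : ℕ} {A : Fin (m + 2) → ℤ} {a : Fin (m + 2) → ℕ} {p : Fin 2 → ℂ}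

theorem pd_sub_mem_hypIdeal (hA : ∀ i, A i = a i) (ha0 : a 0 = 1) (β : ℂ)
    {q : Fin (m + 2) → ℂ} (j : Fin (m + 2)) :
    (pd j - pd 0 ^ a j : DStalk q) ∈ hypIdeal A β q := by
  by_cases hj : j = 0
  · subst hj
    rw [ha0, pow_one, sub_self]
    exact zero_mem _
  -- As `a 0 = 1`, the vector with entry 1 at `j` and `-a j` at `0` is in the kernel of the row.
  · refine Submodule.subset_span (Or.inl
      ⟨fun i => (Pi.single j 1 : Fin (m + 2) → ℤ) i - (Pi.single 0 (a j : ℤ) : Fin (m + 2) → ℤ) i,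
        ?_, ?_⟩)
    · simp [mul_sub, Finset.sum_sub_distrib, Pi.single_apply, hA, ha0]
    · rw [box]
      congr 1
      · rw [← pow_one (pd j), ← pdPow_single]
        congr 1
        funext i
        by_cases hi : i = j
        · subst hi; simp [hj]
        · by_cases hi0 : i = 0
          · subst hi0; simp [Ne.symm hj]
          · simp [hi, hi0]
      · rw [← pdPow_single]
        congr 1
        funext i
        by_cases hi : i = j
        · subst hi; simp [hj]
        · by_cases hi0 : i = 0
          · subst hi0; simp [Ne.symm hj]
          · simp [hi, hi0]

theorem word_sub_mem_hypIdeal (hA : ∀ i, A i = a i) (ha0 : a 0 = 1) (β : ℂ)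
    {q : Fin (m + 2) → ℂ} (w : List (Fin (m + 2))) :
    ((List.map pd w).prod - pd 0 ^ (w.map a).sum : DStalk q) ∈ hypIdeal A β q := by
  induction w with
  | nil => simp
  | cons j w ih =>
    rw [List.map_cons, List.prod_cons, List.map_cons, List.sum_cons]
    have h1 := Submodule.smul_mem _ (pd j) ih
    have h2 := Submodule.smul_mem _ (pd 0 ^ (w.map a).sum)
      (pd_sub_mem_hypIdeal hA ha0 β (q := q) j)
    rw [smul_eq_mul, mul_sub] at h1 h2
    rw [((pd_commute 0 j).pow_left _).eq, ← pow_add, add_comm _ (a j)] at h2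
    simpa using add_mem h1 h2

/-- The classes of the powers of `∂₁` generate the restriction. -/
theorem rStalk_mk_fn_mul_word (hA : ∀ i, A i = a i) (ha0 : a 0 = 1) (β : ℂ)
    (φ : HolGerm (incl m p)) (w : List (Fin (m + 2))) :
    RStalk.mk A β p (fn φ * (List.map pd w).prod) =
      fn (restr m p φ) • RStalk.mk A β p (pd 0 ^ (w.map a).sum) := by
  rw [rStalk_mk_fn_mul]
  congr 1
  rw [rStalk_mk_eq]
  exact hypIdeal_le_restrSub (word_sub_mem_hypIdeal hA ha0 β w)

theorem pd_smul_rStalk_mk (hA : ∀ i, A i = a i) (ha0 : a 0 = 1) (β : ℂ)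
    (j : Fin 2) (l : ℕ) :
    (pd j : DStalk p) • RStalk.mk A β p (pd 0 ^ l) =
      RStalk.mk A β p (pd 0 ^ (a (Fin.natAdd m j) + l)) := by
  rw [smul_rStalk_mk, extOp_pd, rStalk_mk_eq]
  apply hypIdeal_le_restrSub
  have := word_sub_mem_hypIdeal hA ha0 β (q := incl m p)
    (Fin.natAdd m j :: List.replicate l 0)
  simpa [ha0] using this

theorem pd_pow_smul_rStalk_mk (hA : ∀ i, A i = a i) (ha0 : a 0 = 1) (β : ℂ)
    (j : Fin 2) (u l : ℕ) :
    (pd j ^ u : DStalk p) • RStalk.mk A β p (pd 0 ^ l) =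
      RStalk.mk A β p (pd 0 ^ (a (Fin.natAdd m j) * u + l)) := by
  induction u with
  | zero => simp
  | succ u ih =>
    rw [pow_succ', mul_smul, ih, pd_smul_rStalk_mk hA ha0]
    congr 2
    ring

/-- The Weyl commutator of a power of `∂₁` with a coordinate. At `l = 0` the truncated exponent is
harmless because its coefficient vanishes. -/
theorem pd_pow_mul_coord {q : Fin (m + 2) → ℂ} (j : Fin (m + 2)) (l : ℕ) :
    (pd 0 ^ l * fn (coord j) : DStalk q) =
      fn (coord j) * pd 0 ^ l + if j = 0 then (l : DStalk q) * pd 0 ^ (l - 1) else 0 := by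
  induction l with
  | zero => simp
  | succ l ih =>
    rw [pow_succ', mul_assoc, ih, mul_add, ← mul_assoc, pd_fn, partialGerm_coord]
    by_cases hj : j = 0
    · subst hj
      have h1 : fn (1 : HolGerm q) = 1 := by
        have := fn_const (p := q) 1
        rwa [map_one] at this
      have h2 : (pd 0 * ((l : DStalk q) * pd 0 ^ (l - 1)) : DStalk q) = (l : DStalk q) * pd 0 ^ l := by
        rcases l with _ | l
        · simp
        · rw [Nat.add_sub_cancel, ← mul_assoc, ← (Nat.cast_commute (l + 1) (pd 0)).eq, mul_assoc,
            ← pow_succ']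
      simp only [if_true, h1, h2, Nat.add_sub_cancel, add_mul, one_mul, mul_assoc]
      push_cast
      rw [add_mul, one_mul]
      abel
    · have h0 : fn (0 : HolGerm q) = 0 := by
        have := fn_const (p := q) 0
        rwa [map_zero] at this
      rw [if_neg hj, if_neg (Ne.symm hj), if_neg hj, h0]
      simp [mul_assoc]

/-- The Euler operator in the last two variables kills the class of `∂₁ ^ l`. -/
theorem euler_smul_rStalk_mk (hA : ∀ i, A i = a i) (ha0 : a 0 = 1) (β : ℂ)
    (l : ℕ) :
    (euler (fun j => A (Fin.natAdd m j)) (β - l) : DStalk p) • RStalk.mk A β p (pd 0 ^ l) = 0 := by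
  rw [smul_rStalk_mk, rStalk_mk_eq_zero]
  -- Commuting `∂₁ ^ l` past `x₁ ∂₁` in `∂₁ ^ l E_A(β)` adds `l ∂₁ ^ l`; subtracting the terms that
  -- begin with one of the first `m` coordinates leaves the Euler operator of the last two
  -- variables.
  refine ⟨pd 0 ^ l * euler A β, Submodule.smul_mem _ (pd 0 ^ l)
    (Submodule.subset_span (Or.inr rfl)),
    fun i => -((A (Fin.castAdd 2 i) : ℂ) • (pd (Fin.castAdd 2 i) * pd 0 ^ l)), ?_⟩
  have h1 : ∀ j, (pd 0 ^ l * ((A j : ℂ) • (fn (coord j) * pd j)) : DStalk (incl m p)) =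
      (A j : ℂ) • (fn (coord j) * (pd j * pd 0 ^ l)) +
        if j = 0 then (l : DStalk (incl m p)) * pd 0 ^ l else 0 := by
    intro j
    rw [mul_smul_comm, ← mul_assoc, pd_pow_mul_coord, add_mul, smul_add, mul_assoc,
      ((pd_commute 0 j).pow_left l).eq]
    congr 1
    split_ifs with hj
    · subst hj
      rw [hA, ha0]
      rcases l with _ | l
      · simp
      · rw [Nat.add_sub_cancel, mul_assoc, ← pow_succ]
        simp
    · simp
  have h2 : (pd 0 ^ l * euler A β : DStalk (incl m p)) =
      ∑ j, (A j : ℂ) • (fn (coord j) * (pd j * pd 0 ^ l)) +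
        (l : DStalk (incl m p)) * pd 0 ^ l - algebraMap ℂ _ β * pd 0 ^ l := by
    rw [euler, mul_sub, Finset.mul_sum, Finset.sum_congr rfl fun j _ => h1 j,
      Finset.sum_add_distrib, Finset.sum_ite_eq', if_pos (Finset.mem_univ _),
      (Algebra.commutes β _).symm]
  have h3 : extOp m p (euler (fun j => A (Fin.natAdd m j)) (β - l)) =
      ∑ j : Fin 2, (A (Fin.natAdd m j) : ℂ) • (fn (coord (Fin.natAdd m j)) *
        pd (Fin.natAdd m j)) - algebraMap ℂ _ β + (l : DStalk (incl m p)) := by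
    rw [euler, map_sub, map_sum, AlgHom.commutes, map_sub, map_natCast, ← sub_add]
    congr 2
    refine Finset.sum_congr rfl fun j _ => ?_
    rw [map_smul, map_mul, extOp_fn, extOp_pd, pull_coord]
  rw [h2, h3, Fin.sum_univ_add, add_mul, sub_mul, Finset.sum_mul]
  simp only [smul_mul_assoc, mul_assoc, mul_neg, mul_smul_comm, Finset.sum_neg_distrib]
  abel

theorem pdPow_smul_rStalk_mk (hA : ∀ i, A i = a i) (ha0 : a 0 = 1) (β : ℂ)
    (u : Fin 2 → ℕ) (l : ℕ) :
    (pdPow u : DStalk p) • RStalk.mk A β p (pd 0 ^ l) =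
      RStalk.mk A β p (pd 0 ^ (∑ j, a (Fin.natAdd m j) * u j + l)) := by
  rw [show (pdPow u : DStalk p) = pd 0 ^ u 0 * pd 1 ^ u 1 by simp [pdPow, List.ofFn_succ],
    mul_smul, pd_pow_smul_rStalk_mk hA ha0, pd_pow_smul_rStalk_mk hA ha0, Fin.sum_univ_two,
    add_assoc]

/-- This makes the map from the hypergeometric system of the last two entries with parameter `β -
l`, sending `1` to the class of `∂₁ ^ l`, well defined. -/
theorem hypIdeal_smul_rStalk_mk (hA : ∀ i, A i = a i) (ha0 : a 0 = 1) (β : ℂ)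
    (l : ℕ) {P : DStalk p}
    (hP : P ∈ hypIdeal (fun j => A (Fin.natAdd m j)) (β - l) p) :
    P • RStalk.mk A β p (pd 0 ^ l) = 0 := by
  induction hP using Submodule.span_induction with
  | mem x hx =>
    rcases hx with ⟨u, hu, rfl⟩ | rfl
    · have h : ∑ j, a (Fin.natAdd m j) * (u j).toNat = ∑ j, a (Fin.natAdd m j) * (-u j).toNat := by
        zify
        rw [← sub_eq_zero, ← Finset.sum_sub_distrib, ← hu]
        refine Finset.sum_congr rfl fun i _ => ?_
        simp only [hA]
        rw [← mul_sub]
        congr 1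
        omega
      rw [box, sub_smul, pdPow_smul_rStalk_mk hA ha0, pdPow_smul_rStalk_mk hA ha0, h, sub_self]
    · exact euler_smul_rStalk_mk hA ha0 β l
  | zero => rw [zero_smul]
  | add x y _ _ hx hy => rw [add_smul, hx, hy, add_zero]
  | smul Q x _ hx => rw [smul_eq_mul, mul_smul, hx, smul_zero]

/-- The classes of the powers `∂₁ ^ cᵢ` satisfy no other relations. -/
theorem mem_hypIdeal_of_sum_smul_eq_zero (hA : ∀ i, A i = a i) (ha0 : a 0 = 1) (β : ℂ)
    (ha : ∀ i, 0 < a i) {k : ℕ} {c : Fin k → ℕ}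
    (hdisj : ∀ i j s t, IsComb (fun j => a (Fin.natAdd m j)) s →
      IsComb (fun j => a (Fin.natAdd m j)) t → c i + s = c j + t → i = j)
    (hβ : ∀ l : ℕ, β = l → ∃ i s, IsComb (fun j => a (Fin.natAdd m j)) s ∧ l = c i + s)
    (P : Fin k → DStalk p) (h : ∑ i, P i • RStalk.mk A β p (pd 0 ^ c i) = 0) (i : Fin k) :
    P i ∈ hypIdeal (fun j => A (Fin.natAdd m j)) (β - c i) p := by
  have hsum : ∑ i, P i • RStalk.mk A β p (pd 0 ^ c i) =
      RStalk.mk A β p (∑ i, extOp m p (P i) * pd 0 ^ c i) :=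
    (map_sum (AddMonoidHom.mk' (RStalk.mk A β p) (rStalk_mk_add A β))
      (fun i => extOp m p (P i) * pd 0 ^ c i) Finset.univ).symm
  rw [hsum, rStalk_mk_eq_zero] at h
  obtain ⟨g, hg⟩ := map_restr_act_restrSub hA h
  refine mem_hypIdeal_of_sum_eq_eulerEnd (a := fun j => a (Fin.natAdd m j)) (fun j => hA _)
    (fun j => ha _) hdisj hβ P g ?_ i
  rw [← hg, map_sum, LinearMap.sum_apply, Polynomial.map_sum]
  refine Finset.sum_congr rfl fun i _ => ?_
  have h1 := act_pd_pow_X_pow a (p := incl m p) 0 (c i) 0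
  rw [pow_zero, ha0, one_mul, add_zero] at h1
  rw [act_mul, map_restr_act_extOp, h1, Polynomial.map_pow, map_X]
  have h2 := act_X_pow_mul (fun j => a (Fin.natAdd m j)) (P i) (c i) 1
  rw [mul_one] at h2
  exact h2.symm

end RestrictionStalk

/-! ### The isomorphism of sheaves -/

section Sections

/-- The operator `∂ⱼ` on an open set. -/
def pdPre {n : ℕ} (U : Opens (Fin n → ℂ)) (j : Fin n) : DPre U :=
  ⟨fun _ => pd j, Algebra.subset_adjoin (Or.inr ⟨j, rfl⟩)⟩

/-- A holomorphic function on an open set, as an operator. -/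
def fnPre {n : ℕ} {U : Opens (Fin n → ℂ)} (f : (Fin n → ℂ) → ℂ)
    (hf : ∀ q : U, AnalyticAt ℂ f q.1) : DPre U :=
  ⟨fun q => fn (germ f (hf q)), Algebra.subset_adjoin (Or.inl ⟨f, hf, rfl⟩)⟩

/-- The section of the restriction given by `∂₁ ^ l`. -/
def powSec {m : ℕ} (A : Fin (m + 2) → ℤ) (β : ℂ) (U : Opens (Fin 2 → ℂ)) (l : ℕ) :
    ∀ q : U, RStalk A β q.1 :=
  fun q => RStalk.mk A β q.1 (pd 0 ^ l)

/-! ### Generation with holomorphic coefficients -/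

variable {m : ℕ} {A : Fin (m + 2) → ℤ} {a : Fin (m + 2) → ℕ} {β : ℂ} {k : ℕ} {c : Fin k → ℕ}

/-- Descending induction on `l`: in the union of the `c i + S`, apply derivatives to a generator;
outside it `β ≠ l`, and the Euler relation expresses `∂₁ ^ l` by higher powers with polynomial
coefficients. -/
theorem powSec_mem_span (hA : ∀ i, A i = a i) (ha0 : a 0 = 1) (ha : ∀ i, 0 < a i)
    (hβ : ∀ l : ℕ, β = l → ∃ i s, IsComb (fun j => a (Fin.natAdd m j)) s ∧ l = c i + s)
    (hcof : ∃ N, ∀ l ≥ N, ∃ i s, IsComb (fun j => a (Fin.natAdd m j)) s ∧ l = c i + s)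
    (U : Opens (Fin 2 → ℂ)) (l : ℕ) :
    powSec A β U l ∈ Submodule.span (DPre U) (Set.range fun i => powSec A β U (c i)) := by
  set M := Submodule.span (DPre U) (Set.range fun i => powSec A β U (c i))
  have hT : ∀ l, (∃ i s, IsComb (fun j => a (Fin.natAdd m j)) s ∧ l = c i + s) →
      powSec A β U l ∈ M := by
    rintro _ ⟨i, _, ⟨u, v, rfl⟩, rfl⟩
    have e : powSec A β U (c i + (a (Fin.natAdd m 0) * u + a (Fin.natAdd m 1) * v)) =
        (pdPre U 0 ^ u * pdPre U 1 ^ v) • powSec A β U (c i) := by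
      funext q
      change _ = (pd 0 ^ u * pd 1 ^ v : DStalk q.1) • RStalk.mk A β q.1 (pd 0 ^ c i)
      rw [mul_smul, pd_pow_smul_rStalk_mk hA ha0, pd_pow_smul_rStalk_mk hA ha0, powSec]
      congr 2
      ring
    rw [e]
    exact M.smul_mem _ (Submodule.subset_span ⟨i, rfl⟩)
  obtain ⟨N, hN⟩ := hcof
  -- `d` bounds how far `l` lies below the range `l ≥ N` that the union covers.
  have key : ∀ d l, N ≤ l + d → powSec A β U l ∈ M := by
    intro d
    induction d with
    | zero => exact fun l hl => hT l (hN l hl)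
    | succ d ih =>
      intro l hl
      by_cases hl' : ∃ i s, IsComb (fun j => a (Fin.natAdd m j)) s ∧ l = c i + s
      · exact hT l hl'
      have hne : β - l ≠ 0 := fun h => hl' (hβ l (sub_eq_zero.1 h))
      have e : powSec A β U l = algebraMap ℂ (DPre U) (β - l)⁻¹ •
          ∑ j : Fin 2, (algebraMap ℂ (DPre U) (A (Fin.natAdd m j)) *
            fnPre (fun x => x j) (fun q => analyticAt_coord j q.1)) •
              powSec A β U (a (Fin.natAdd m j) + l) := by
        funext q
        have h := euler_smul_rStalk_mk hA ha0 β (p := q.1) l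
        rw [euler, sub_smul, Finset.sum_smul, sub_eq_zero] at h
        have h1 : ∀ j : Fin 2, ((A (Fin.natAdd m j) : ℂ) • (fn (coord j) * pd j) : DStalk q.1) •
            RStalk.mk A β q.1 (pd 0 ^ l) =
            (algebraMap ℂ (DStalk q.1) (A (Fin.natAdd m j)) * fn (coord j)) •
              RStalk.mk A β q.1 (pd 0 ^ (a (Fin.natAdd m j) + l)) := by
          intro j
          rw [Algebra.smul_def, ← mul_assoc, mul_smul, pd_smul_rStalk_mk hA ha0]
        rw [Finset.sum_congr rfl fun j _ => h1 j] at h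
        rw [Fin.sum_univ_two] at h ⊢
        change RStalk.mk A β q.1 (pd 0 ^ l) = algebraMap ℂ (DStalk q.1) (β - l)⁻¹ •
          ((algebraMap ℂ (DStalk q.1) (A (Fin.natAdd m 0)) * fn (coord 0)) •
              RStalk.mk A β q.1 (pd 0 ^ (a (Fin.natAdd m 0) + l)) +
            (algebraMap ℂ (DStalk q.1) (A (Fin.natAdd m 1)) * fn (coord 1)) •
              RStalk.mk A β q.1 (pd 0 ^ (a (Fin.natAdd m 1) + l)))
        rw [h, ← mul_smul, ← map_mul, inv_mul_cancel₀ hne, map_one, one_smul]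
      rw [e]
      refine M.smul_mem _ (sum_mem fun j _ => M.smul_mem _ (ih _ ?_))
      have := ha (Fin.natAdd m j)
      omega
  exact key N l (Nat.le_add_left _ _)

theorem mk_mem_span (hA : ∀ i, A i = a i) (ha0 : a 0 = 1) (ha : ∀ i, 0 < a i)
    (hβ : ∀ l : ℕ, β = l → ∃ i s, IsComb (fun j => a (Fin.natAdd m j)) s ∧ l = c i + s)
    (hcof : ∃ N, ∀ l ≥ N, ∃ i s, IsComb (fun j => a (Fin.natAdd m j)) s ∧ l = c i + s)
    {V : Opens (Fin (m + 2) → ℂ)} {P : ∀ q : V, DStalk q.1} (hP : P ∈ DPre V) :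
    (fun q : slice (m := m) (r := 2) V => RStalk.mk A β q.1 (P ⟨incl m q.1, q.2⟩)) ∈
      Submodule.span (DPre (slice (m := m) (r := 2) V))
        (Set.range fun i => powSec A β (slice (m := m) (r := 2) V) (c i)) := by
  have hcl := DPre_le_closure hP
  clear hP
  induction hcl using AddSubmonoid.closure_induction with
  | mem x hx =>
    obtain ⟨f, hf, w, rfl⟩ := hx
    have e : (fun q : slice (m := m) (r := 2) V => RStalk.mk A β q.1
        (fn (germ f (hf ⟨incl m q.1, q.2⟩)) * (List.map pd w).prod)) =
        fnPre (fun x => f (incl m x)) (fun q : slice (m := m) (r := 2) V =>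
          analyticAt_comp_incl (hf ⟨incl m q.1, q.2⟩)) •
          powSec A β (slice (m := m) (r := 2) V) (w.map a).sum := by
      funext q
      rw [rStalk_mk_fn_mul_word hA ha0, restr_germ]
      rfl
    rw [e]
    exact Submodule.smul_mem _ _ (powSec_mem_span hA ha0 ha hβ hcof _ _)
  | zero => exact zero_mem _
  | add x y _ _ hx hy => exact add_mem hx hy

/-! ### The comparison map on stalks and sections -/

variable {A' : Fin 2 → ℤ} {b : Fin k → ℂ}

/-- The map `ℳ_{A'}(b) → 𝒟 / (𝒟 H_A(β) + (x₁, …, xₘ) 𝒟)` on stalks that maps `1` to `∂₁ ^ l`. -/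
def stalkMap (hA : ∀ i, A i = a i) (ha0 : a 0 = 1) {b : ℂ} {l : ℕ} {p : Fin 2 → ℂ}
    (hI : hypIdeal A' b p = hypIdeal (fun j => A (Fin.natAdd m j)) (β - l) p) :
    MStalk A' b p →ₗ[DStalk p] RStalk A β p :=
  (hypIdeal A' b p).liftQ (LinearMap.toSpanSingleton (DStalk p) _ (RStalk.mk A β p (pd 0 ^ l)))
    fun P hP => by
      rw [hI] at hP
      rw [LinearMap.mem_ker, LinearMap.toSpanSingleton_apply]
      exact hypIdeal_smul_rStalk_mk hA ha0 β l hP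

theorem stalkMap_mkQ (hA : ∀ i, A i = a i) (ha0 : a 0 = 1) {b : ℂ} {l : ℕ} {p : Fin 2 → ℂ}
    (hI : hypIdeal A' b p = hypIdeal (fun j => A (Fin.natAdd m j)) (β - l) p) (P : DStalk p) :
    stalkMap hA ha0 hI ((hypIdeal A' b p).mkQ P) = P • RStalk.mk A β p (pd 0 ^ l) := rfl

theorem stalkMap_mem_RSec (hA : ∀ i, A i = a i) (ha0 : a 0 = 1) {b : ℂ} {l : ℕ}
    (hI : ∀ p, hypIdeal A' b p = hypIdeal (fun j => A (Fin.natAdd m j)) (β - l) p)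
    {U : Opens (Fin 2 → ℂ)} (t : MSec A' b U) :
    (fun q : U => stalkMap hA ha0 (hI q.1) (t.1 q)) ∈ RSec A β U := by
  intro p
  obtain ⟨V, hV, hpV, P, hP, h1⟩ := t.2 p
  obtain ⟨W, hW, hpW, h2⟩ := hP ⟨p.1, hpV⟩
  obtain ⟨Q, hQ, h3⟩ := exists_extOp_mem_DPre m h2
  refine ⟨cyl m W, ?_, Q * fun _ => pd 0 ^ l, mul_mem (mem_DSec_of_mem_DPre hQ)
    (mem_DSec_of_mem_DPre (pdPre (cyl m W) 0 ^ l).2), fun q hq => ?_⟩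
  · change projL m 2 (incl m p.1) ∈ W
    rwa [projL_incl]
  · have hqW : q.1 ∈ W := by
      have : projL m 2 (incl m q.1) ∈ W := hq
      rwa [projL_incl] at this
    have e : t.1 q = (hypIdeal A' b q.1).mkQ (P ⟨q.1, hW hqW⟩) := h1 ⟨q.1, hW hqW⟩
    change stalkMap hA ha0 (hI q.1) (t.1 q) = _
    rw [e, stalkMap_mkQ, Pi.mul_apply, h3 ⟨q.1, hqW⟩ hq]
    rfl

/-- The sum of the maps `stalkMap`, on sections. -/
def secMap (hA : ∀ i, A i = a i) (ha0 : a 0 = 1)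
    (hI : ∀ i p, hypIdeal A' (b i) p = hypIdeal (fun j => A (Fin.natAdd m j)) (β - c i) p)
    (U : Opens (Fin 2 → ℂ)) : (∀ i : Fin k, MSec A' (b i) U) →ₗ[DSec U] RSec A β U where
  toFun t := ∑ i, ⟨fun q : U => stalkMap hA ha0 (hI i q.1) ((t i).1 q),
    stalkMap_mem_RSec hA ha0 (hI i) (t i)⟩
  map_add' t t' := by
    rw [← Finset.sum_add_distrib]
    refine Finset.sum_congr rfl fun i _ => Subtype.ext (funext fun q => ?_)
    exact map_add (stalkMap hA ha0 (hI i q.1)) ((t i).1 q) ((t' i).1 q)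
  map_smul' Q t := by
    rw [RingHom.id_apply, Finset.smul_sum]
    refine Finset.sum_congr rfl fun i _ => Subtype.ext (funext fun q => ?_)
    exact map_smul (stalkMap hA ha0 (hI i q.1)) (Q.1 q) ((t i).1 q)

theorem secMap_apply (hA : ∀ i, A i = a i) (ha0 : a 0 = 1)
    (hI : ∀ i p, hypIdeal A' (b i) p = hypIdeal (fun j => A (Fin.natAdd m j)) (β - c i) p)
    (U : Opens (Fin 2 → ℂ)) (t : ∀ i : Fin k, MSec A' (b i) U) (q : U) :
    (secMap hA ha0 hI U t).1 q = ∑ i, stalkMap hA ha0 (hI i q.1) ((t i).1 q) := by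
  change (∑ i, (⟨fun q : U => stalkMap hA ha0 (hI i q.1) ((t i).1 q),
    stalkMap_mem_RSec hA ha0 (hI i) (t i)⟩ : RSec A β U) : RSec A β U).1 q = _
  rw [AddSubmonoidClass.coe_finsetSum, Finset.sum_apply]

theorem stalkMap_sum_injective (hA : ∀ i, A i = a i) (ha0 : a 0 = 1) (ha : ∀ i, 0 < a i)
    (hI : ∀ i p, hypIdeal A' (b i) p = hypIdeal (fun j => A (Fin.natAdd m j)) (β - c i) p)
    (hdisj : ∀ i j s t, IsComb (fun j => a (Fin.natAdd m j)) s →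
      IsComb (fun j => a (Fin.natAdd m j)) t → c i + s = c j + t → i = j)
    (hβ : ∀ l : ℕ, β = l → ∃ i s, IsComb (fun j => a (Fin.natAdd m j)) s ∧ l = c i + s)
    {p : Fin 2 → ℂ} (t t' : ∀ i, MStalk A' (b i) p)
    (h : ∑ i, stalkMap hA ha0 (hI i p) (t i) = ∑ i, stalkMap hA ha0 (hI i p) (t' i)) (i : Fin k) :
    t i = t' i := by
  choose P hP using fun i => (hypIdeal A' (b i) p).mkQ_surjective (t i - t' i)
  rw [← sub_eq_zero, ← Finset.sum_sub_distrib] at h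
  simp only [← map_sub, ← hP, stalkMap_mkQ] at h
  have := mem_hypIdeal_of_sum_smul_eq_zero hA ha0 β ha hdisj hβ P h i
  rw [← hI i p] at this
  rw [← sub_eq_zero, ← hP i]
  exact (Submodule.Quotient.mk_eq_zero _).2 this

/-- Near each point the coefficients of the generators can be taken in operators on one
neighbourhood, which is what surjectivity on sections requires. -/
theorem exists_eq_sum_smul (hA : ∀ i, A i = a i) (ha0 : a 0 = 1) (ha : ∀ i, 0 < a i)
    (hβ : ∀ l : ℕ, β = l → ∃ i s, IsComb (fun j => a (Fin.natAdd m j)) s ∧ l = c i + s)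
    (hcof : ∃ N, ∀ l ≥ N, ∃ i s, IsComb (fun j => a (Fin.natAdd m j)) s ∧ l = c i + s)
    {U : Opens (Fin 2 → ℂ)} (s : RSec A β U) (p : U) :
    ∃ (W : Opens (Fin 2 → ℂ)) (h : W ≤ U) (_ : p.1 ∈ W) (Q : Fin k → DPre W),
      ∀ q : W, s.1 ⟨q.1, h q.2⟩ = ∑ i, (Q i).1 q • RStalk.mk A β q.1 (pd 0 ^ c i) := by
  obtain ⟨V, hpV, P, hP, h1⟩ := s.2 p
  obtain ⟨V', hV', hpV', h2⟩ := hP ⟨incl m p.1, hpV⟩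
  obtain ⟨Q, hQ⟩ := (Submodule.mem_span_range_iff_exists_fun _).1
    (mk_mem_span hA ha0 ha hβ hcof h2)
  refine ⟨slice V' ⊓ U, inf_le_right, ⟨hpV', p.2⟩,
    fun i => ⟨_, resFun_mem_DPre inf_le_left (Q i).2⟩, fun q => ?_⟩
  rw [h1 ⟨q.1, q.2.2⟩ (hV' q.2.1)]
  have h3 := congrFun hQ ⟨q.1, q.2.1⟩
  rw [Finset.sum_apply] at h3
  exact h3.symm

/-- The restriction is a direct sum of hypergeometric systems, if the sets `cᵢ + S` are disjoint,
have a finite complement in `ℕ`, and `β` is not in this complement. Here `S` is the semigroup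
generated by the last two entries of `A`. -/
theorem restrictionIso_of_isComb (hA : ∀ i, A i = a i) (ha0 : a 0 = 1) (ha : ∀ i, 0 < a i)
    (hI : ∀ i p, hypIdeal A' (b i) p = hypIdeal (fun j => A (Fin.natAdd m j)) (β - c i) p)
    (hdisj : ∀ i j s t, IsComb (fun j => a (Fin.natAdd m j)) s →
      IsComb (fun j => a (Fin.natAdd m j)) t → c i + s = c j + t → i = j)
    (hβ : ∀ l : ℕ, β = l → ∃ i s, IsComb (fun j => a (Fin.natAdd m j)) s ∧ l = c i + s)
    (hcof : ∃ N, ∀ l ≥ N, ∃ i s, IsComb (fun j => a (Fin.natAdd m j)) s ∧ l = c i + s) :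
    RestrictionIso (m := m) (r := 2) A β A' b := by
  have hbij : ∀ U, Function.Bijective (secMap hA ha0 hI U) := by
    intro U
    constructor
    · intro t t' h
      funext i
      refine Subtype.ext (funext fun q => ?_)
      refine stalkMap_sum_injective hA ha0 ha hI hdisj hβ (fun i => (t i).1 q)
        (fun i => (t' i).1 q) ?_ i
      rw [← secMap_apply, ← secMap_apply, h]
    · intro s
      -- The preimage is defined at each point by the local coefficients chosen for that point.
      -- Injectivity on stalks shows that they agree with those of a nearby point, so the family is
      -- a section.
      choose W hW hpW Q hQ using exists_eq_sum_smul hA ha0 ha hβ hcof s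
      refine ⟨fun i => ⟨fun q => (hypIdeal A' (b i) q.1).mkQ ((Q q i).1 ⟨q.1, hpW q⟩),
        fun p => ⟨W p, hW p, hpW p, _, mem_DSec_of_mem_DPre (Q p i).2, fun q => ?_⟩⟩, ?_⟩
      · refine stalkMap_sum_injective hA ha0 ha hI hdisj hβ
          (fun i => (hypIdeal A' (b i) q.1).mkQ ((Q ⟨q.1, hW p q.2⟩ i).1 ⟨q.1, hpW _⟩))
          (fun i => (hypIdeal A' (b i) q.1).mkQ ((Q p i).1 q)) ?_ i
        simp only [stalkMap_mkQ]
        exact (hQ ⟨q.1, hW p q.2⟩ ⟨q.1, hpW _⟩).symm.trans (hQ p q)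
      · refine Subtype.ext (funext fun q => ?_)
        rw [secMap_apply]
        simp only [stalkMap_mkQ]
        exact (hQ q ⟨q.1, hpW q⟩).symm
  refine ⟨fun U => (LinearEquiv.ofBijective _ (hbij U)).symm, fun U V h s i => ?_⟩
  obtain ⟨t, rfl⟩ := (LinearEquiv.ofBijective _ (hbij U)).surjective s
  -- The inverse commutes with restriction because `secMap`, being defined pointwise, does.
  have e : RSec.res h (LinearEquiv.ofBijective _ (hbij U) t) =
      LinearEquiv.ofBijective _ (hbij V) fun i => MSec.res h (t i) := by
    refine Subtype.ext (funext fun q => ?_)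
    change (secMap hA ha0 hI U t).1 ⟨q.1, h q.2⟩ = (secMap hA ha0 hI V _).1 q
    rw [secMap_apply, secMap_apply]
    rfl
  rw [e, LinearEquiv.symm_apply_apply, LinearEquiv.symm_apply_apply]

end Sections

/-! ### Numerical semigroups and the choice of the parameters -/

/-- Scaling the row does not change its kernel and multiplies the Euler operator by a nonzero
constant. -/
theorem hypIdeal_intCast_mul {n : ℕ} (A : Fin n → ℤ) (β : ℂ) {κ : ℤ} (hκ : κ ≠ 0) (p : Fin n → ℂ) :
    hypIdeal (fun j => κ * A j) (κ * β) p = hypIdeal A β p := by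
  have hbox : ∀ u : Fin n → ℤ, ∑ j, κ * A j * u j = 0 ↔ ∑ j, A j * u j = 0 := by
    intro u
    simp only [mul_assoc, ← Finset.mul_sum, mul_eq_zero, hκ, false_or]
  have he : (euler (fun j => κ * A j) (κ * β) : DStalk p) =
      algebraMap ℂ (DStalk p) κ * euler A β := by
    rw [euler, euler, mul_sub, Finset.mul_sum, map_mul]
    congr 1
    refine Finset.sum_congr rfl fun j _ => ?_
    rw [← Algebra.smul_def, smul_smul, Int.cast_mul]
  have hκ' : (κ : ℂ) ≠ 0 := Int.cast_ne_zero.2 hκ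
  have he' : (euler A β : DStalk p) =
      algebraMap ℂ (DStalk p) (κ : ℂ)⁻¹ * euler (fun j => κ * A j) (κ * β) := by
    rw [he, ← mul_assoc, ← map_mul, inv_mul_cancel₀ hκ', map_one, one_mul]
  refine le_antisymm (Submodule.span_le.2 ?_) (Submodule.span_le.2 ?_)
  · rintro _ (⟨u, hu, rfl⟩ | rfl)
    · exact Submodule.subset_span (Or.inl ⟨u, (hbox u).1 hu, rfl⟩)
    · rw [he]
      exact Submodule.smul_mem _ _ (Submodule.subset_span (Or.inr rfl))
  · rintro _ (⟨u, hu, rfl⟩ | rfl)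
    · exact Submodule.subset_span (Or.inl ⟨u, (hbox u).2 hu, rfl⟩)
    · rw [he']
      exact Submodule.smul_mem _ _ (Submodule.subset_span (Or.inr rfl))

theorem isComb_zero (a : Fin 2 → ℕ) : IsComb a 0 := ⟨0, 0, by simp⟩

theorem IsComb.gcd_dvd {a : Fin 2 → ℕ} {s : ℕ} (h : IsComb a s) : Nat.gcd (a 0) (a 1) ∣ s := by
  obtain ⟨u, v, rfl⟩ := h
  exact dvd_add ((Nat.gcd_dvd_left _ _).mul_right u) ((Nat.gcd_dvd_right _ _).mul_right v)

theorem exists_isComb_of_ge (a : Fin 2 → ℕ) :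
    ∃ N, ∀ l ≥ N, Nat.gcd (a 0) (a 1) ∣ l → IsComb a l := by
  obtain ⟨N, hN⟩ := Nat.exists_mem_closure_of_ge {a 0, a 1}
  refine ⟨N, fun l hl hd => ?_⟩
  have h := hN l hl ((Nat.dvd_gcd (Nat.setGcd_dvd_of_mem (by simp))
    (Nat.setGcd_dvd_of_mem (by simp))).trans hd)
  obtain ⟨u, v, rfl⟩ := (AddSubmonoid.mem_closure_pair _ _ _).1 h
  exact ⟨u, v, by simp [mul_comm]⟩

/-- Elements of the semigroup are multiples of `k`, so the residue modulo `k` determines the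
translate. -/
theorem isComb_add_disjoint {a : Fin 2 → ℕ} {k : ℕ} (hk : Nat.gcd (a 0) (a 1) = k) {c : Fin k → ℕ}
    (hc : ∀ i, c i % k = i) (i j : Fin k) (s t : ℕ) (hs : IsComb a s) (ht : IsComb a t)
    (h : c i + s = c j + t) : i = j := by
  obtain ⟨s, rfl⟩ := hk ▸ hs.gcd_dvd
  obtain ⟨t, rfl⟩ := hk ▸ ht.gcd_dvd
  have := congrArg (· % k) h
  simp only [Nat.add_mul_mod_self_left, hc] at this
  exact Fin.ext this

theorem isComb_add_cofinite {a : Fin 2 → ℕ} {k : ℕ} (hk : Nat.gcd (a 0) (a 1) = k) (hk0 : 0 < k)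
    {c : Fin k → ℕ} (hc : ∀ i, c i % k = i) :
    ∃ N, ∀ l ≥ N, ∃ i s, IsComb a s ∧ l = c i + s := by
  obtain ⟨N, hN⟩ := exists_isComb_of_ge a
  -- Adding all `c i` keeps `l - c i` at least `N` for whichever `i` is the residue of `l`.
  refine ⟨N + ∑ i, c i, fun l hl => ?_⟩
  set i : Fin k := ⟨l % k, Nat.mod_lt _ hk0⟩
  have hi : c i ≤ ∑ i, c i := Finset.single_le_sum (fun _ _ => Nat.zero_le _) (Finset.mem_univ i)
  refine ⟨i, l - c i, hN _ (by omega) ?_, by omega⟩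
  rw [hk]
  exact (Nat.modEq_iff_dvd' (by omega)).1 (hc i)

/-! ### Choice of the parameters -/

variable {m : ℕ} {A : Fin (m + 2) → ℤ} {a : Fin (m + 2) → ℕ} {A' : Fin 2 → ℤ} {κ : ℤ} {k : ℕ}

theorem restrictionIso_of_mod_eq (hA : ∀ i, A i = a i) (ha0 : a 0 = 1) (ha : ∀ i, 0 < a i)
    (hκ : κ ≠ 0) (hA' : ∀ j, A (Fin.natAdd m j) = κ * A' j)
    (hk : Nat.gcd (a (Fin.natAdd m 0)) (a (Fin.natAdd m 1)) = k) (hk0 : 0 < k) {β : ℂ}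
    {c : Fin k → ℕ} (hc : ∀ i, c i % k = i)
    (hβ : ∀ l : ℕ, β = l → ∃ i s, IsComb (fun j => a (Fin.natAdd m j)) s ∧ l = c i + s) :
    RestrictionIso (m := m) (r := 2) A β A' (fun i => (β - c i) / κ) := by
  refine restrictionIso_of_isComb hA ha0 ha (fun i p => ?_) (isComb_add_disjoint hk hc) hβ
    (isComb_add_cofinite hk hk0 hc)
  rw [← hypIdeal_intCast_mul A' _ hκ, mul_div_cancel₀ _ (Int.cast_ne_zero.2 hκ)]
  simp only [hA']

/-- The restriction of a hypergeometric system with `a₁ = 1` to the last two variables. -/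
theorem restrictionIso_of_gcd (hA : ∀ i, A i = a i) (ha0 : a 0 = 1) (ha : ∀ i, 0 < a i)
    (hκ : κ ≠ 0) (hA' : ∀ j, A (Fin.natAdd m j) = κ * A' j)
    (hk : Nat.gcd (a (Fin.natAdd m 0)) (a (Fin.natAdd m 1)) = k) :
    (∀ β : ℂ, ∃ b : Fin k → ℂ, RestrictionIso (m := m) (r := 2) A β A' b) ∧
      {β : ℂ | ¬ RestrictionIso (m := m) (r := 2) A β A'
        (fun i : Fin k => (β - (i : ℕ)) / κ)}.Finite := by
  have hk0 : 0 < k := hk ▸ Nat.gcd_pos_of_pos_left _ (ha _)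
  have hc : ∀ i : Fin k, (i : ℕ) % k = i := fun i => Nat.mod_eq_of_lt i.2
  constructor
  · intro β
    by_cases hβ : ∃ l : ℕ, β = l
    · obtain ⟨l, rfl⟩ := hβ
      -- For `β = l` the representative of the residue of `l` is `l` itself, so that `β` lies in its
      -- own translate with `s = 0`.
      refine ⟨_, restrictionIso_of_mod_eq hA ha0 ha hκ hA' hk hk0
        (c := fun i => if (i : ℕ) = l % k then l else i) (fun i => ?_) fun l' hl' => ?_⟩
      · split_ifs with h
        · exact h.symm
        · exact hc i
      · obtain rfl : l = l' := Nat.cast_injective hl'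
        exact ⟨⟨l % k, Nat.mod_lt _ hk0⟩, 0, isComb_zero _, by simp⟩
    · exact ⟨_, restrictionIso_of_mod_eq hA ha0 ha hκ hA' hk hk0 hc
        fun l hl => absurd ⟨l, hl⟩ hβ⟩
  · obtain ⟨N, hN⟩ := isComb_add_cofinite (a := fun j => a (Fin.natAdd m j)) hk hk0 hc
    -- With `c i = i`, every exceptional `β` is a natural number below `N`.
    refine ((Set.finite_Iio N).image (fun l : ℕ => (l : ℂ))).subset fun β hβ => ?_
    by_contra hβ'
    refine hβ (restrictionIso_of_mod_eq hA ha0 ha hκ hA' hk hk0 hc fun l hl => hN l ?_)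
    by_contra hlt
    exact hβ' ⟨l, not_le.1 hlt, hl.symm⟩

end GKZ

end

/-! ### The two statements -/

theorem mainTheorem6 :
    (∀ k a b : ℕ, 1 ≤ a → a < b → 1 < k * a → k * a < k * b → Nat.Coprime a b →
      (∀ β : ℂ, ∃ β' : Fin k → ℂ,
        GKZ.RestrictionIso (m := 1) (r := 2) ![1, (k * a : ℤ), (k * b : ℤ)] β
          ![(a : ℤ), (b : ℤ)] β') ∧
      {β : ℂ | ¬ GKZ.RestrictionIso (m := 1) (r := 2) ![1, (k * a : ℤ), (k * b : ℤ)] β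
          ![(a : ℤ), (b : ℤ)] (fun i : Fin k => (β - (i : ℕ)) / k)}.Finite) ∧
    (∀ (m : ℕ) (A : Fin (m + 2) → ℤ), A 0 = 1 → StrictMono A →
      (∀ β : ℂ, ∃ β' : Fin (Int.gcd (A (Fin.natAdd m 0)) (A (Fin.natAdd m 1))) → ℂ,
        GKZ.RestrictionIso (m := m) (r := 2) A β
          ![A (Fin.natAdd m 0), A (Fin.natAdd m 1)] β') ∧
      {β : ℂ | ¬ GKZ.RestrictionIso (m := m) (r := 2) A β
          ![A (Fin.natAdd m 0), A (Fin.natAdd m 1)]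
          (fun i : Fin (Int.gcd (A (Fin.natAdd m 0)) (A (Fin.natAdd m 1))) =>
            β - (i : ℕ))}.Finite) := by
  refine ⟨fun k a b ha hab hka _ hco => ?_, fun m A hA0 hmono => ?_⟩
  · have hk : 0 < k := Nat.pos_of_mul_pos_right (by omega : 0 < k * a)
    -- The last two entries are `k` times the coprime pair, so the scale is `κ = k`, which produces
    -- the division by `k`.
    have key := GKZ.restrictionIso_of_gcd (m := 1) (A := ![1, (k * a : ℤ), (k * b : ℤ)])
      (a := ![1, k * a, k * b]) (A' := ![(a : ℤ), (b : ℤ)]) (κ := k) (k := k)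
      (fun i => by fin_cases i <;> simp) rfl
      (fun i => by
        have hb : 0 < b := by omega
        fin_cases i
        · exact one_pos
        · exact Nat.mul_pos hk ha
        · exact Nat.mul_pos hk hb)
      (by exact_mod_cast hk.ne') (fun j => by fin_cases j <;> rfl)
      (by
        change Nat.gcd (k * a) (k * b) = k
        rw [Nat.gcd_mul_left, hco.gcd_eq_one, mul_one])
    simpa only [Int.cast_natCast] using key
  · have hpos : ∀ i, 0 < A i := fun i => by
      have := hmono.monotone (Fin.zero_le i)
      omega
    have hA : ∀ i, A i = ((A i).toNat : ℤ) := fun i => (Int.toNat_of_nonneg (hpos i).le).symm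
    -- Here the last two entries are kept as they are, so the scale is `κ = 1`.
    have key := GKZ.restrictionIso_of_gcd (A := A) (a := fun i => (A i).toNat)
      (A' := ![A (Fin.natAdd m 0), A (Fin.natAdd m 1)]) (κ := 1)
      (k := Int.gcd (A (Fin.natAdd m 0)) (A (Fin.natAdd m 1))) hA (by simp [hA0])
      (fun i => by have := hpos i; simp [this]) one_ne_zero
      (fun j => by fin_cases j <;> simp)
      (by
        conv_rhs => rw [hA (Fin.natAdd m 0), hA (Fin.natAdd m 1)]
        rfl)
    simpa only [Int.cast_one, div_one] using key
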